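/- **Setting.** All parameters $k,s,t,u,w,N,N_{\mathrm{iter}}$ are functions of $n\in\mathbb N$ with $k\le n$, $s\le n$, $u\le t$, $u\le n-s$. Let $\mathbf e\in\mathbb F_2^n$ have Hamming weight $t$, let $\mathscr C=\{\mathbf c:\mathbf H\mathbf c^{\top}=0\}$ for an $(n-k)\times n$ binary matrix $\mathbf H$, let $\mathscr C^{\perp}$ be its dual (the set of parity-checks of $\mathscr C$), and let $\mathbf y=\mathbf c+\mathbf e$ with $\mathbf c\in\mathscr C$ be the received word. For a set $\mathscr P$ of $s$ positions with complement $\mathscr N$, write $\mathbf x_{\mathscr P},\mathbf x_{\mathscr N}$ for restrictions. Put $$K_w^{m}(x)=\sum_{j=0}^{w}(-1)^j\binom{x}{j}\binom{m-x}{w-j},\qquad \delta=\frac{K_w^{n-s}(u)}{\binom{n-s}{w}},\qquad P_{\mathrm{succ}}=\frac{\binom{s}{t-u}\binom{n-s}{u}}{\binom nt}.$$ **The RLPN decoder.** It performs at most $N_{\mathrm{iter}}$ iterations. Each iteration draws a uniform set $\mathscr P$ of $s$ positions, calls a routine $\mathrm{Create}(N,w,\mathscr P)$ which writes $N$ different parity-checks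 $\mathbf h\in\mathscr C^\perp$ with $|\mathbf h_{\mathscr N}|=w$, and forms the $N$ samples $(\mathbf a_i,b_i)=(\mathbf h_{\mathscr P},\langle\mathbf y,\mathbf h\rangle)$, in which the same $\mathbf a$ may occur several times. With $p'_i=\frac{1-\delta}2$ if $b_i=0$ and $p'_i=\frac{1+\delta}2$ if $b_i=1$, it computes $$p(\mathbf a)=\frac{\prod_{i:\mathbf a_i=\mathbf a}p'_i}{\prod_{i:\mathbf a_i=\mathbf a}p'_i+\prod_{i:\mathbf a_i=\mathbf a}(1-p'_i)},\qquad f(\mathbf a)=\begin{cases}\log\frac{1-p(\mathbf a)}{p(\mathbf a)}&\text{if }\mathbf a\text{ occurs among the }\mathbf a_i,\\0&\text{otherwise,}\end{cases}$$ the fast Fourier transform $\widehat f(\mathbf x)=\sum_{\mathbf a\in\mathbb F_2^s}f(\mathbf a)(-1)^{\langle\mathbf x,\mathbf a\rangle}$, and a maximizer $\mathbf x_0$ of $\widehat f$. If $\widehat f(\mathbf x_0)\ge\frac{\delta N}{2}\log\frac{1+\delta}{1-\delta}$, it stops and outputs $\mathscr P$ and $\mathbf x_0$ (as the candidate for $\mathbf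 e_{\mathscr P}$); otherwise it goes on to the next iteration. Costs are counted on a unit-cost random access machine with real-valued cells; time is the number of steps and space is the number of cells that are accessed. Assume that each call of Create takes time at most $T_{\mathrm{eq}}$ and that all the calls work within one set of $S_{\mathrm{eq}}$ cells, their output (all $Nn$ coordinates are accessed) included. **Claim.** 1. The probability over a uniform $\mathscr P$ that $|\mathbf e_{\mathscr N}|=u$ equals $P_{\mathrm{succ}}$. 2. The decoder program does what is described above: on any $N$ samples an iteration returns a maximizer of $\widehat f$ if the maximum reaches the threshold, and nothing otherwise; and the samples used in the iterations are LPN samples $(\mathbf h_{\mathscr P},\langle\mathbf e_{\mathscr P},\mathbf h_{\mathscr P}\rangle+\langle\mathbf e_{\mathscr N},\mathbf h_{\mathscr N}\rangle)$ with parity-checks $\mathbf h$ as above. 3. For $n,N\ge1$ and all codes, received words, sets $\mathscr P$ and admissible routines Create, the space and the time of the decoder are $$S=O\left(S_{\mathrm{eq}}+2^s\right),\qquad T=O\left(N_{\mathrm{iter}}\left(T_{\mathrm{eq}}+(s+1)2^s\right)\right).$$ Consequently, if $N\ge 1$ and $P_{\mathrm{succ}}>0$ for all large $n$, and $N_{\mathrm{iter}}=\frac1{P_{\mathrm{succ}}}$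 up to a factor at most polylogarithmic in $\frac{T_{\mathrm{eq}}+2^s}{P_{\mathrm{succ}}}$ (as an upper bound), then $$T=\widetilde O\left(\frac{T_{\mathrm{eq}}+2^s}{P_{\mathrm{succ}}}\right),$$ where $\widetilde O(g)$ means $O(g\log^a g)$ for some $a$. 4. Let $\mathbf H$ be uniformly random, and assume the LPN model: given the code, the iterations are independent, and given $\mathscr P$ the $N$ samples of an iteration are independent, each being $(\mathbf a,\langle\mathbf a,\mathbf e_{\mathscr P}\rangle+\eta)$ with $\mathbf a$ uniform in $\mathbb F_2^s$ and $\eta$ an independent Bernoulli variable of parameter $\frac{1-\varepsilon}2$, where $\varepsilon=\Pr(\langle\mathbf e_{\mathscr N},\mathbf h_{\mathscr N}\rangle=0)-\Pr(\langle\mathbf e_{\mathscr N},\mathbf h_{\mathscr N}\rangle=1)$ for $\mathbf h$ uniform among the parity-checks of $\mathscr C$ with $|\mathbf h_{\mathscr N}|=w$ ($\varepsilon=0$ if there are none). If, for all large $n$, $|\delta|<1$ and $$N\le\frac{\binom{n-s}{w}}{2^{k-s}},$$ and if $$N=\omega\left(n\left(\frac{\binom{n-s}{w}}{K_w^{n-s}(u)}\right)^2\right)\quad\text{and}\quad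 N_{\mathrm{iter}}=\omega\left(\frac1{P_{\mathrm{succ}}}\right),$$ then the probability (over the code, the sets $\mathscr P$ and the samples) that the decoder outputs a set $\mathscr P$ together with the correct $\mathbf e_{\mathscr P}$ is $1-o(1)$ as $n\to\infty$. -/

import Mathlib

namespace RLPN

noncomputable section

/-! ### Codes and parity-checks -/

/-- The code `{c : H cᵀ = 0}` with parity-check matrix `H`. -/
def code {m n : ℕ} (H : Matrix (Fin m) (Fin n) (ZMod 2)) : Set (Fin n → ZMod 2) :=
  {c | H.mulVec c = 0}

/-- The dual code: the parity-checks of `C`. -/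
def dual {n : ℕ} (C : Set (Fin n → ZMod 2)) : Set (Fin n → ZMod 2) :=
  {d | ∀ c ∈ C, dotProduct c d = 0}

/-- The sets `𝒫` of `s` positions among `n`. -/
abbrev Pos (n s : ℕ) : Type := {P : Finset (Fin n) // P.card = s}

/-- The `s`-bit words, i.e. the elements of `𝔽₂ˢ`. -/
abbrev Word (s : ℕ) : Type := Fin s → ZMod 2

/-- The position number `l` of `𝒫`, in increasing order. -/
def position {n s : ℕ} (P : Pos n s) (l : Fin s) : Fin n := P.1.orderEmbOfFin P.2 l

/-- The restriction `x_𝒫`. -/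
def onP {n s : ℕ} (P : Pos n s) (x : Fin n → ZMod 2) : Word s := fun l => x (position P l)

/-- The Hamming weight `|x_𝒩|` where `𝒩` is the complement of `𝒫`. -/
def weightN {n s : ℕ} (P : Pos n s) (x : Fin n → ZMod 2) : ℕ :=
  ((P.1)ᶜ.filter fun j => x j ≠ 0).card

/-- The scalar product `⟨x_𝒩, h_𝒩⟩`. -/
def dotN {n s : ℕ} (P : Pos n s) (x h : Fin n → ZMod 2) : ZMod 2 :=
  ∑ j ∈ (P.1)ᶜ, x j * h j

/-- `Pr(g(h) = 0) - Pr(g(h) = 1)` for `h` uniform in the finite set `S`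
(and `0` if `S` is empty). -/
def bias {α : Type} (S : Finset α) (g : α → ZMod 2) : ℝ :=
  (((S.filter fun h => g h = 0).card : ℝ) - ((S.filter fun h => g h = 1).card : ℝ)) / (S.card : ℝ)

open Classical in
/-- The parity-checks `h` of `C` such that `|h_𝒩| = w`. -/
def checks {n s : ℕ} (C : Set (Fin n → ZMod 2)) (w : ℕ) (P : Pos n s) :
    Finset (Fin n → ZMod 2) :=
  Finset.univ.filter fun h => h ∈ dual C ∧ weightN P h = w

/-- The bias `ε` of the LPN samples: the bias of `⟨e_𝒩, h_𝒩⟩` for `h` uniform among the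
parity-checks of `C` of weight `w` on `𝒩`. -/
def lpnBias {n s : ℕ} (C : Set (Fin n → ZMod 2)) (w : ℕ) (e : Fin n → ZMod 2) (P : Pos n s) : ℝ :=
  bias (checks C w P) (dotN P e)

/-- The Krawtchouk polynomial `K_w^n` at an integer `0 ≤ x ≤ n`. -/
def krawtchouk (n w x : ℕ) : ℝ :=
  ∑ j ∈ Finset.range (w + 1), (-1 : ℝ) ^ j * (x.choose j : ℝ) * ((n - x).choose (w - j) : ℝ)

/-- The estimated bias `δ = K_w^{n-s}(u) / C(n-s, w)`. -/
def estBias (n s u w : ℕ) : ℝ := krawtchouk (n - s) w u / ((n - s).choose w : ℝ)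

/-- `P_succ = C(s, t-u) C(n-s, u) / C(n, t)` (for `u ≤ t`). -/
def pSucc (n s t u : ℕ) : ℝ :=
  ((s.choose (t - u) : ℝ) * ((n - s).choose u : ℝ)) / (n.choose t : ℝ)

/-- `f = ω(g)`. -/
def IsOmega (f g : ℕ → ℝ) : Prop :=
  Filter.Tendsto (fun n => |f n| / g n) Filter.atTop Filter.atTop

/-! ### The log-likelihood function of a list of LPN samples -/

/-- An LPN sample `(a, b)`, where `b` is a noisy version of `⟨a, secret⟩`. -/
abbrev Sample (s : ℕ) : Type := Word s × ZMod 2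

/-- The samples with secret `x`, vectors `a i` and noise `η i`. -/
def lpnSamples {s N : ℕ} (x : Word s) (a : Fin N → Word s) (η : Fin N → ZMod 2) :
    Fin N → Sample s :=
  fun i => (a i, dotProduct x (a i) + η i)

/-- `p'ᵢ`: the noise probability `(1-δ)/2` if the sample bit is `0`, and `1` minus it otherwise. -/
def pFlip (δ : ℝ) (b : ZMod 2) : ℝ := if b = 0 then (1 - δ) / 2 else 1 - (1 - δ) / 2

/-- The probability `p(a)` that `⟨a, secret⟩ = 1` given all the samples with this same `a`. -/
def pOne {s N : ℕ} (δ : ℝ) (smp : Fin N → Sample s) (a : Word s) : ℝ :=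
  (∏ i with (smp i).1 = a, pFlip δ (smp i).2) /
    ((∏ i with (smp i).1 = a, pFlip δ (smp i).2) +
      ∏ i with (smp i).1 = a, (1 - pFlip δ (smp i).2))

open Classical in
/-- The log-likelihood function `f`. -/
def llr {s N : ℕ} (δ : ℝ) (smp : Fin N → Sample s) (a : Word s) : ℝ :=
  if ∃ i, (smp i).1 = a then Real.log ((1 - pOne δ smp a) / pOne δ smp a) else 0

/-- The Fourier transform on `𝔽₂ˢ`. -/
def fourier {s : ℕ} (f : Word s → ℝ) (x : Word s) : ℝ :=
  ∑ a, f a * (-1 : ℝ) ^ (dotProduct x a).val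

/-- The acceptance threshold: `δ N / 2`, in the scale of the log-likelihood function, in which
each sample counts for `± log ((1+δ)/(1-δ))` instead of `± 1`. -/
def threshold (δ : ℝ) (N : ℕ) : ℝ := δ * N / 2 * Real.log ((1 + δ) / (1 - δ))

/-- What one iteration has to return on given samples: a maximizer `x₀` of the Fourier transform
of `f` if the maximum reaches the threshold, and nothing otherwise. -/
def IterSpec {s N : ℕ} (δ : ℝ) (smp : Fin N → Sample s) (r : Option (Word s)) : Prop :=
  (r = none ∧ ∀ x, fourier (llr δ smp) x < threshold δ N) ∨
  ∃ x₀, r = some x₀ ∧ (∀ x, fourier (llr δ smp) x ≤ fourier (llr δ smp) x₀) ∧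
    threshold δ N ≤ fourier (llr δ smp) x₀

/-! ### Machine model

A random access machine with unit cost: the cells hold real numbers, and reading a cell, writing a
cell, and an operation on a bounded number of registers (arithmetic, logarithm, comparison, address
computation) take one step each. -/

/-- The addresses, organized in disjoint arrays. -/
inductive Cell (s : ℕ) : Type
  /-- received word -/
  | inp (j : ℕ)
  /-- parity-check matrix of the code -/
  | mat (i j : ℕ)
  /-- the chosen positions -/
  | pos (l : ℕ)
  /-- coordinate `j` of the parity-check number `i` -/
  | chk (i j : ℕ)
  /-- bit `l` of the vector `a` of the sample number `i` -/
  | smpA (i : ℕ) (l : Fin s)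
  /-- second component of the sample number `i` -/
  | smpB (i : ℕ)
  /-- product of the `p'ᵢ` -/
  | num (x : Word s)
  /-- product of the `1 - p'ᵢ` -/
  | den (x : Word s)
  /-- the vector on which the fast Fourier transform is performed in place -/
  | tab (x : Word s)
  /-- scratch memory -/
  | scr (z : ℕ)

abbrev Mem (s : ℕ) : Type := Cell s → ℝ

/-- Programs. -/
inductive Prog (s : ℕ) (α : Type) : Type
  | ret (a : α) : Prog s α
  | read (c : Cell s) (k : ℝ → Prog s α) : Prog s α
  | write (c : Cell s) (v : ℝ) (k : Prog s α) : Prog s α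
  | tick (k : Prog s α) : Prog s α

namespace Prog

variable {s : ℕ} {α β ι : Type}

def bind : Prog s α → (α → Prog s β) → Prog s β
  | ret a, f => f a
  | read c k, f => read c fun v => bind (k v) f
  | write c v k, f => write c v (bind k f)
  | tick k, f => tick (bind k f)

instance : Monad (Prog s) where
  pure := ret
  bind := bind

open Classical in
/-- Result and final memory. -/
def run : Prog s α → Mem s → α × Mem s
  | ret a, m => (a, m)
  | read c k, m => run (k (m c)) m
  | write c v k, m => run k (Function.update m c v)
  | tick k, m => run k m

open Classical in
/-- Number of steps. -/
def time : Prog s α → Mem s → ℕ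
  | ret _, _ => 0
  | read c k, m => time (k (m c)) m + 1
  | write c v k, m => time k (Function.update m c v) + 1
  | tick k, m => time k m + 1

open Classical in
/-- The set of cells that are read or written. -/
def cells : Prog s α → Mem s → Finset (Cell s)
  | ret _, _ => ∅
  | read c k, m => insert c (cells (k (m c)) m)
  | write c v k, m => insert c (cells k (Function.update m c v))
  | tick k, m => cells k m

/-- A loop over a list, with a register. Each turn costs one step for the loop control. -/
def loop (l : List ι) (body : ι → β → Prog s β) (b : β) : Prog s β :=
  match l with
  | [] => ret b
  | i :: l => tick (bind (body i b) fun b' => loop l body b')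

def forEach (l : List ι) (body : ι → Prog s Unit) : Prog s Unit :=
  loop l (fun i _ => body i) ()

/-- Read the cell `c`. -/
def rd (c : Cell s) : Prog s ℝ := read c ret
/-- Write the value `v`, obtained by one operation on registers, in the cell `c`. -/
def wr (c : Cell s) (v : ℝ) : Prog s Unit := tick (write c v (ret ()))
/-- Return a value obtained by one operation on registers. -/
def op (a : α) : Prog s α := tick (ret a)

end Prog

open Prog

/-- All the `s`-bit words. -/
def words (s : ℕ) : List (Word s) := (Finset.univ : Finset (Word s)).toList

/-- A bit as the content of a cell, and back. -/
def bit (b : ZMod 2) : ℝ := if b = 0 then 0 else 1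
def unbit (r : ℝ) : ZMod 2 := if r = 0 then 0 else 1

/-! ### The decoder -/

/-- Reads the vector `a` of the sample number `i`, bit by bit. -/
def readWord {s : ℕ} (i : ℕ) : Prog s (Word s) :=
  loop (List.finRange s) (fun l a => do
    let v ← rd (.smpA i l)
    op (Function.update a l (unbit v))) 0

/-- Computes the vector `f` from the `N` samples in memory. A word `a` that occurs in no sample has
two empty products, hence `p(a) = 1/2` and `f(a) = log 1 = 0`. -/
def buildTable (s N : ℕ) (δ : ℝ) : Prog s Unit := do
  forEach (words s) fun x => do
    wr (.num x) 1
    wr (.den x) 1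
  forEach (List.finRange N) fun i => do
    let a ← readWord i
    let b ← rd (.smpB i)
    let p ← op (pFlip δ (unbit b))
    let v ← rd (.num a)
    wr (.num a) (v * p)
    let q ← op (1 - p)
    let v' ← rd (.den a)
    wr (.den a) (v' * q)
  forEach (words s) fun x => do
    let v ← rd (.num x)
    let v' ← rd (.den x)
    let d ← op (v + v')
    let p ← op (v / d)
    let q ← op (1 - p)
    let r ← op (q / p)
    wr (.tab x) (Real.log r)

/-- The in-place fast Fourier transform of the vector `tab`. -/
def fft (s : ℕ) : Prog s Unit :=
  forEach (List.finRange s) fun l =>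
    forEach (words s) fun x =>
      if x l = 0 then do
        let x' ← op (Function.update x l 1)
        let v ← rd (.tab x)
        let v' ← rd (.tab x')
        wr (.tab x) (v + v')
        wr (.tab x') (v - v')
      else op ()

/-- A word where `tab` is maximal, with the maximum. -/
def argmax (s : ℕ) : Prog s (Word s × ℝ) := do
  let v₀ ← rd (.tab 0)
  loop (words s) (fun x best => do
    let v ← rd (.tab x)
    op (if best.2 < v then (x, v) else best)) (0, v₀)

/-- The second half of an iteration: solves the LPN problem given by the `N` samples in memory. -/
def solve (s N : ℕ) (δ : ℝ) : Prog s (Option (Word s)) := do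
  buildTable s N δ
  fft s
  let best ← argmax s
  op (if threshold δ N ≤ best.2 then some best.1 else none)

/-- The outer loop. Each entry of the list is one iteration: a set `𝒫`, and a program that puts
`N` samples in the memory. The output is the set `𝒫` of the first iteration which is accepted,
together with the candidate `x₀` for `e_𝒫`. -/
def decoder {n s : ℕ} (N : ℕ) (δ : ℝ) :
    List (Pos n s × Prog s Unit) → Prog s (Option (Pos n s × Word s))
  | [] => ret none
  | (P, source) :: rest => do
    source
    let r ← solve s N δ
    match r with
    | some x₀ => op (some (P, x₀))
    | none => tick (decoder N δ rest)

/-- Puts the given samples in the memory. -/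
def load {s N : ℕ} (smp : Fin N → Sample s) : Prog s Unit :=
  forEach (List.finRange N) fun i => do
    forEach (List.finRange s) fun l => wr (.smpA i l) (bit ((smp i).1 l))
    wr (.smpB i) (bit (smp i).2)

/-- The first half of an iteration with the set `𝒫`: writes `𝒫`, calls the routine `create` which
writes `N` parity-checks `h`, and computes the LPN samples `(h_𝒫, ⟨y, h⟩)`. The choice of `𝒫` is
charged `n` steps on top of the writing. -/
def source {n s : ℕ} (N : ℕ) (P : Pos n s) (create : Prog s Unit) : Prog s Unit := do
  forEach (List.finRange n) fun _ => op ()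
  forEach (List.finRange s) fun l => wr (.pos l) ((position P l : ℕ) : ℝ)
  create
  forEach (List.finRange N) fun i => do
    forEach (List.finRange s) fun l => do
      let v ← rd (.pos l)
      let h ← rd (.chk i ⌊v⌋₊)
      wr (.smpA i l) h
    let b ← loop (List.finRange n) (fun j b => do
      let h ← rd (.chk i (j : ℕ))
      let v ← rd (.inp (j : ℕ))
      op (b + unbit h * unbit v)) (0 : ZMod 2)
    wr (.smpB i) (bit b)

/-- The memory holds the received word `y` and the parity-check matrix `H`. -/
def InputLoaded {n m s : ℕ} (y : Fin n → ZMod 2) (H : Matrix (Fin m) (Fin n) (ZMod 2))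
    (M : Mem s) : Prop :=
  (∀ j : Fin n, M (.inp j) = bit (y j)) ∧ ∀ (i : Fin m) (j : Fin n), M (.mat i j) = bit (H i j)

/-- The memory holds the set `𝒫`. -/
def PosLoaded {n s : ℕ} (P : Pos n s) (M : Mem s) : Prop :=
  ∀ l : Fin s, M (.pos l) = ((position P l : ℕ) : ℝ)

/-- The memory holds the vectors `h i`, `i < N`. -/
def ChecksLoaded {n s N : ℕ} (h : Fin N → Fin n → ZMod 2) (M : Mem s) : Prop :=
  ∀ (i : Fin N) (j : Fin n), M (.chk i j) = bit (h i j)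

/-- The `N` vectors `h i` are different parity-checks of weight `w` on `𝒩` of the code. -/
def AreChecks {n s N : ℕ} (C : Set (Fin n → ZMod 2)) (w : ℕ) (P : Pos n s)
    (h : Fin N → Fin n → ZMod 2) : Prop :=
  Function.Injective h ∧ ∀ i, h i ∈ checks C w P

/-- `create` produces `N` parity-checks of weight `w` on `𝒩` of the code with parity-check matrix
`H`, in time at most `Teq` and within the set `W` of cells (its output being part of these cells),
and leaves its input unchanged. A randomized routine is one such program for each outcome of its
random choices. -/
def IsCreate {n m s : ℕ} (y : Fin n → ZMod 2) (H : Matrix (Fin m) (Fin n) (ZMod 2)) (N w : ℕ)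
    (Teq : ℕ) (W : Finset (Cell s)) (P : Pos n s) (create : Prog s Unit) : Prop :=
  ∀ M : Mem s, InputLoaded y H M → PosLoaded P M →
    create.time M ≤ Teq ∧ create.cells M ⊆ W ∧
    (∀ (i : Fin N) (j : Fin n), Cell.chk (i : ℕ) (j : ℕ) ∈ create.cells M) ∧
    InputLoaded y H (create.run M).2 ∧ PosLoaded P (create.run M).2 ∧
    ∃ h : Fin N → Fin n → ZMod 2, AreChecks (code H) w P h ∧ ChecksLoaded h (create.run M).2

/-- The decoder with `Niter` iterations, given the sets and the calls of `create`. -/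
def rlpn {n s Niter : ℕ} (N : ℕ) (δ : ℝ) (P : Fin Niter → Pos n s)
    (create : Fin Niter → Prog s Unit) : Prog s (Option (Pos n s × Word s)) :=
  decoder N δ (List.ofFn fun j => (P j, source N (P j) (create j)))

/-- The decoder with `Niter` iterations, run on given samples. -/
def rlpnOn {n s N Niter : ℕ} (δ : ℝ) (it : Fin Niter → Pos n s × (Fin N → Sample s)) :
    Prog s (Option (Pos n s × Word s)) :=
  decoder N δ (List.ofFn fun j => ((it j).1, load (it j).2))

/-- Everything that one execution of the decoder is about: a code given by an `(n-k) × n`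
parity-check matrix, a received word `c + e`, the sets of positions, the calls of `create` (each
in time at most `Teq`, all of them within `Seq` cells), and the initial memory. -/
def IsExecution {n s Niter : ℕ} (k N w : ℕ) (Seq Teq : ℕ) (e : Fin n → ZMod 2)
    (H : Matrix (Fin (n - k)) (Fin n) (ZMod 2)) (c : Fin n → ZMod 2) (P : Fin Niter → Pos n s)
    (create : Fin Niter → Prog s Unit) (W : Finset (Cell s)) (M : Mem s) : Prop :=
  c ∈ code H ∧ W.card ≤ Seq ∧ (∀ j, IsCreate (c + e) H N w Teq W (P j) (create j)) ∧
    InputLoaded (c + e) H M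

/-! ### The probabilistic model -/

/-- The law of `m` independent draws from `p`. -/
def iid {α : Type} (p : PMF α) : (m : ℕ) → PMF (Fin m → α)
  | 0 => PMF.pure Fin.elim0
  | m + 1 => p.bind fun a => (iid p m).map fun v => (Fin.cons a v : Fin (m + 1) → α)

/-- A uniform set of `s` positions among `n`. -/
def uniformPos {n s : ℕ} (hs : s ≤ n) : PMF (Pos n s) :=
  haveI : Nonempty (Pos n s) := by
    obtain ⟨P, -, hP⟩ := Finset.exists_subset_card_eq
      (s := (Finset.univ : Finset (Fin n))) (n := s) (by simpa using hs)
    exact ⟨⟨P, hP⟩⟩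
  PMF.uniformOfFintype (Pos n s)

theorem abs_bias_le_one {α : Type} (S : Finset α) (g : α → ZMod 2) : |bias S g| ≤ 1 := by
  have h : (S.filter fun h => g h = 0).card ≤ S.card := Finset.card_filter_le _ _
  have h' : (S.filter fun h => g h = 1).card ≤ S.card := Finset.card_filter_le _ _
  have h1 : ((S.filter fun h => g h = 0).card : ℝ) ≤ S.card := by exact_mod_cast h
  have h2 : ((S.filter fun h => g h = 1).card : ℝ) ≤ S.card := by exact_mod_cast h'
  have h3 : (0 : ℝ) ≤ ((S.filter fun h => g h = 0).card : ℝ) := Nat.cast_nonneg _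
  have h4 : (0 : ℝ) ≤ ((S.filter fun h => g h = 1).card : ℝ) := Nat.cast_nonneg _
  unfold bias
  rw [abs_div, abs_of_nonneg (Nat.cast_nonneg (α := ℝ) S.card)]
  apply div_le_one_of_le₀ _ (Nat.cast_nonneg _)
  rw [abs_le]
  constructor <;> linarith

/-- The Bernoulli law of bias `ε`, i.e. of parameter `Pr(1) = (1-ε)/2`. -/
def bernoulliBias (ε : ℝ) (hε : |ε| ≤ 1) : PMF (ZMod 2) :=
  PMF.ofFintype
    (fun b => if b = 0 then ENNReal.ofReal ((1 + ε) / 2) else ENNReal.ofReal ((1 - ε) / 2)) (by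
    obtain ⟨h1, h2⟩ := abs_le.1 hε
    have h : ∀ f : ZMod 2 → ENNReal, ∑ b, f b = f 0 + f 1 := fun f => Fin.sum_univ_two f
    rw [h, if_pos rfl, if_neg (by decide),
      ← ENNReal.ofReal_add (by linarith) (by linarith)]
    rw [show (1 + ε) / 2 + (1 - ε) / 2 = 1 by ring, ENNReal.ofReal_one])

/-- The LPN oracle with secret `x` and noise of bias `ε`: a sample `(a, ⟨x, a⟩ + η)` with `a`
uniform and `η` an independent Bernoulli variable. -/
def lpnOracle {s : ℕ} (x : Word s) (ε : ℝ) (hε : |ε| ≤ 1) : PMF (Sample s) :=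
  (PMF.uniformOfFintype (Word s)).bind fun a =>
    (bernoulliBias ε hε).map fun η => (a, dotProduct x a + η)

/-- One iteration in the LPN model: a uniform set `𝒫`, and `N` independent samples of the LPN
oracle with secret `e_𝒫`, the bias of the noise being that of `⟨e_𝒩, h_𝒩⟩` for `h` uniform among
the parity-checks of the code of weight `w` on `𝒩`. -/
def iteration {n s : ℕ} (hs : s ≤ n) (N w : ℕ) (e : Fin n → ZMod 2) (C : Set (Fin n → ZMod 2)) :
    PMF (Pos n s × (Fin N → Sample s)) :=
  (uniformPos hs).bind fun P =>
    (iid (lpnOracle (onP P e) (lpnBias C w e P) (abs_bias_le_one _ _)) N).map fun smp => (P, smp)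

/-- The law of the `Niter` iterations of the decoder, independent given the code, for a code chosen
by picking an `(n-k) × n` parity-check matrix uniformly at random. -/
def experiment {n s : ℕ} (hs : s ≤ n) (k N w Niter : ℕ) (e : Fin n → ZMod 2) :
    PMF (Fin Niter → Pos n s × (Fin N → Sample s)) :=
  (PMF.uniformOfFintype (Matrix (Fin (n - k)) (Fin n) (ZMod 2))).bind fun H =>
    iid (iteration hs N w e (code H)) Niter

/-- The output is the restriction of `e` to the set of positions that goes with it. -/
def IsCorrect {n s : ℕ} (e : Fin n → ZMod 2) (r : Option (Pos n s × Word s)) : Prop :=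
  ∃ P : Pos n s, r = some (P, onP P e)

end

end RLPN

/-!
Time and space. A triple for a program bounds its running time and the cells it touches together
with what it computes, so the costs of the Fourier transform, `(s + 1) 2 ^ s` steps on `2 ^ s`
words, and of the passes over the `N` checks add up. As a call of Create accesses all `N n`
coordinates of its output, these passes are absorbed in `Teq` and `Seq`.

Correctness. Since `log ((1 - p a) / p a)` is the sum of the log-likelihood ratios of the samples
with vector `a`, the transform at `x` is `log ((1 + δ) / (1 - δ))` times the sum of
`(-1) ^ (b + ⟨x, a⟩)` over the samples `(a, b)`, and the acceptance threshold asks this sum to be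
`δ N / 2`. The sum has mean `ε N` at the secret and mean `0` at any other word, so by Chernoff
bounds and `N = ω(n / δ ^ 2)` an iteration accepts a wrong word with probability at most
`exp (-15 n)`, whatever `ε` is, and it accepts the secret with probability at least `1 / 2` if
`δ ε ≥ 3 / 4 δ ^ 2`.

For a fixed set of positions, this last inequality holds for most codes: the words of the dual of
a random code are the combinations of the rows of `H`, two different nonzero combinations are
independent and uniform, and the sums of `1` and of `(-1) ^ ⟨e, h⟩` over all words of weight `w`
outside the positions are `2 ^ s` times a binomial coefficient and a Krawtchouk value of ratio `δ`.
The bound on `N` makes the expected number of checks large, so both sums concentrate by Chebyshev.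
By Markov, for most codes at least half of the sets with `u` errors outside them are then good, so
that an iteration outputs the secret with probability at least `Psucc / 4`. As `1 / Psucc ≤ 2 ^ n`,
a wrong acceptance comes first only with probability `O(exp (-n))`.
-/

namespace RLPN

noncomputable section

open Prog

namespace Prog

variable {s : ℕ} {α β ι : Type}

theorem run_bind (p : Prog s α) (f : α → Prog s β) (m : Mem s) :
    (Prog.bind p f).run m = (f (p.run m).1).run (p.run m).2 := by
  induction p generalizing m with
  | ret a => rfl
  | read c _ ih => exact ih _ _
  | write c v _ ih => exact ih _
  | tick _ ih => exact ih _

theorem time_bind (p : Prog s α) (f : α → Prog s β) (m : Mem s) :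
    (Prog.bind p f).time m = p.time m + (f (p.run m).1).time (p.run m).2 := by
  induction p generalizing m with
  | ret a => exact (zero_add _).symm
  | read c k ih => simp only [Prog.bind, time, run, ih]; omega
  | write c v k ih => simp only [Prog.bind, time, run, ih]; omega
  | tick k ih => simp only [Prog.bind, time, run, ih]; omega

theorem mem_cells_bind (p : Prog s α) (f : α → Prog s β) (m : Mem s) (c : Cell s) :
    c ∈ (Prog.bind p f).cells m ↔
      c ∈ p.cells m ∨ c ∈ (f (p.run m).1).cells (p.run m).2 := by
  induction p generalizing m with
  | ret a => simp [Prog.bind, cells, run]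
  | read c k ih => simp only [Prog.bind, cells, run, Finset.mem_insert, ih, or_assoc]
  | write c v k ih => simp only [Prog.bind, cells, run, Finset.mem_insert, ih, or_assoc]
  | tick k ih => simp only [Prog.bind, cells, run, ih]

theorem card_cells_le_time (p : Prog s α) (m : Mem s) : (p.cells m).card ≤ p.time m := by
  classical
  induction p generalizing m with
  | ret a => exact le_rfl
  | read c k ih => exact (Finset.card_insert_le _ _).trans (Nat.succ_le_succ (ih _ _))
  | write c v k ih => exact (Finset.card_insert_le _ _).trans (Nat.succ_le_succ (ih _))
  | tick k ih => exact (ih m).trans (Nat.le_succ _)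

theorem run_apply_of_notMem_cells (p : Prog s α) (m : Mem s) {c : Cell s}
    (hc : c ∉ p.cells m) : (p.run m).2 c = m c := by
  classical
  induction p generalizing m with
  | ret a => rfl
  | read c' k ih =>
    simp only [cells, Finset.mem_insert, not_or] at hc
    exact ih _ _ hc.2
  | write c' v k ih =>
    simp only [cells, Finset.mem_insert, not_or] at hc
    simp only [run]
    rw [ih _ hc.2, Function.update_of_ne hc.1]
  | tick k ih => exact ih m hc

/-- The Hoare triples of the machine, with resources: started in the memory `m`, the program `p`
makes at most `T` steps, accesses only cells of `W`, and its result and final memory satisfy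
`post`. -/
structure Does (p : Prog s α) (m : Mem s) (T : ℕ) (W : Set (Cell s))
    (post : α → Mem s → Prop) : Prop where
  post : post (p.run m).1 (p.run m).2
  time_le : p.time m ≤ T
  cells_subset : ↑(p.cells m) ⊆ W

namespace Does

variable {p : Prog s α} {m : Mem s} {T T' T₁ T₂ : ℕ} {W W' : Set (Cell s)}
  {post post' : α → Mem s → Prop}

theorem imp (h : Does p m T W post) (hpost : ∀ a m', post a m' → post' a m') :
    Does p m T W post' :=
  ⟨hpost _ _ h.post, h.time_le, h.cells_subset⟩

theorem weaken (h : Does p m T W post) (hT : T ≤ T') (hW : W ⊆ W') : Does p m T' W' post :=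
  ⟨h.post, h.time_le.trans hT, h.cells_subset.trans hW⟩

theorem frame (h : Does p m T W post) :
    Does p m T W fun a m' => post a m' ∧ Set.EqOn m' m Wᶜ :=
  ⟨⟨h.post, fun _ hc => run_apply_of_notMem_cells p m fun hc' => hc (h.cells_subset hc')⟩,
    h.time_le, h.cells_subset⟩

theorem run_eq (h : Does p m T W post) : Does p m T W fun a m' => (a, m') = p.run m :=
  ⟨rfl, h.time_le, h.cells_subset⟩

theorem ret {a : α} (h : post a m) : Does (ret a) m 0 W post :=
  ⟨h, le_rfl, by simp [Prog.cells]⟩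

theorem bind {f : α → Prog s β} {post' : β → Mem s → Prop} (h : Does p m T₁ W post)
    (hf : ∀ a m', post a m' → Does (f a) m' T₂ W post') :
    Does (p >>= f) m (T₁ + T₂) W post' := by
  have h' := hf _ _ h.post
  refine ⟨?_, ?_, fun c hc => ?_⟩
  · exact (run_bind p f m).symm ▸ h'.post
  · exact (time_bind p f m).trans_le (add_le_add h.time_le h'.time_le)
  · exact ((mem_cells_bind p f m c).1 hc).elim (@h.cells_subset c) (@h'.cells_subset c)

theorem tick (h : Does p m T W post) : Does (tick p) m (T + 1) W post :=
  ⟨h.post, Nat.succ_le_succ h.time_le, h.cells_subset⟩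

theorem op {a : α} (h : post a m) : Does (op a) m 1 W post :=
  (Does.ret h).tick

theorem rd {c : Cell s} {post : ℝ → Mem s → Prop} (hc : c ∈ W) (h : post (m c) m) :
    Does (rd c) m 1 W post :=
  ⟨h, le_rfl, by simpa [Prog.rd, Prog.cells] using hc⟩

open Classical in
theorem wr {c : Cell s} {v : ℝ} {post : Unit → Mem s → Prop} (hc : c ∈ W)
    (h : post () (Function.update m c v)) : Does (wr c v) m 2 W post :=
  ⟨h, le_rfl, by simpa [Prog.wr, Prog.cells] using hc⟩

theorem op_bind {a : α} {f : α → Prog s β} {post : β → Mem s → Prop}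
    (h : Does (f a) m T W post) : Does (Prog.op a >>= f) m (T + 1) W post :=
  h.tick

theorem rd_bind {c : Cell s} {f : ℝ → Prog s β} {post : β → Mem s → Prop} (hc : c ∈ W)
    (h : Does (f (m c)) m T W post) : Does (Prog.rd c >>= f) m (T + 1) W post := by
  rw [add_comm]
  refine (Does.rd (post := fun a m' => a = m c ∧ m' = m) hc ⟨rfl, rfl⟩).bind ?_
  rintro _ _ ⟨rfl, rfl⟩
  exact h

open Classical in
theorem wr_bind {c : Cell s} {v : ℝ} {f : Unit → Prog s β} {post : β → Mem s → Prop}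
    (hc : c ∈ W) (h : Does (f ()) (Function.update m c v) T W post) :
    Does (Prog.wr c v >>= f) m (T + 2) W post := by
  rw [add_comm]
  refine (Does.wr (post := fun _ m' => m' = Function.update m c v) hc rfl).bind ?_
  rintro _ _ rfl
  exact h

theorem loop {l : List ι} {body : ι → β → Prog s β} {b : β} (I : List ι → β → Mem s → Prop)
    (hstep : ∀ done i rest, l = done ++ i :: rest → ∀ b m, I done b m →
      Does (body i b) m T W (I (done ++ [i])))
    (h0 : I [] b m) : Does (loop l body b) m (l.length * (T + 1)) W (I l) := by
  suffices from_done : ∀ rest done, l = done ++ rest → ∀ b m, I done b m →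
      Does (Prog.loop rest body b) m (rest.length * (T + 1)) W (I l) from from_done l [] rfl b m h0
  intro rest
  induction rest with
  | nil =>
    rintro done rfl b m hI
    exact (Does.ret (by rwa [List.append_nil])).weaken (Nat.zero_le _) subset_rfl
  | cons i rest ih =>
    intro done hl b m hI
    have turn := ((hstep done i rest hl b m hI).bind fun b' m' h' =>
      ih (done ++ [i]) (by simp [hl]) b' m' h').tick
    exact turn.weaken (by rw [List.length_cons]; linarith) subset_rfl

theorem forEach {l : List ι} {body : ι → Prog s Unit} (I : List ι → Mem s → Prop)
    (hstep : ∀ done i rest, l = done ++ i :: rest → ∀ m, I done m →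
      Does (body i) m T W fun _ => I (done ++ [i]))
    (h0 : I [] m) : Does (forEach l body) m (l.length * (T + 1)) W fun _ => I l :=
  Does.loop (fun l _ => I l) (fun done i rest hl _ m => hstep done i rest hl m) h0

theorem forEach_of_nodup {l : List ι} (hl : l.Nodup) {body : ι → Prog s Unit}
    (R Q : ι → Mem s → Prop)
    (hstep : ∀ i m, R i m → Does (body i) m T W fun _ m' =>
      Q i m' ∧ ∀ j ≠ i, (R j m → R j m') ∧ (Q j m → Q j m'))
    (h0 : ∀ i, R i m) :
    Does (Prog.forEach l body) m (l.length * (T + 1)) W fun _ m' => ∀ i ∈ l, Q i m' := by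
  refine (Does.forEach (fun done m' => (∀ i ∉ done, R i m') ∧ ∀ i ∈ done, Q i m')
    (fun done i rest hsplit m' hm' => ?_) ⟨fun i _ => h0 i, by simp⟩).imp fun _ _ h => h.2
  have hi : i ∉ done := fun h =>
    List.disjoint_of_nodup_append (hsplit ▸ hl) h List.mem_cons_self
  refine (hstep i m' (hm'.1 i hi)).imp fun _ m'' h => ⟨fun j hj => ?_, fun j hj => ?_⟩
  · simp only [List.mem_append, List.mem_singleton, not_or] at hj
    exact (h.2 j hj.2).1 (hm'.1 j hj.1)
  · by_cases hji : j = i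
    · exact hji ▸ h.1
    · exact (h.2 j hji).2 (hm'.2 j (by simpa [hji] using hj))

theorem forEach_forall {l : List ι} {body : ι → Prog s Unit} (Inv : Mem s → Prop)
    (Q : ι → Mem s → Prop)
    (hstep : ∀ i m, Inv m → Does (body i) m T W fun _ m' =>
      Inv m' ∧ Q i m' ∧ ∀ j ≠ i, Q j m → Q j m')
    (h0 : Inv m) :
    Does (Prog.forEach l body) m (l.length * (T + 1)) W fun _ m' => Inv m' ∧ ∀ i ∈ l, Q i m' := by
  refine Does.forEach (fun done m' => Inv m' ∧ ∀ i ∈ done, Q i m')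
    (fun done i rest _ m' hm' => ?_) ⟨h0, by simp⟩
  refine (hstep i m' hm'.1).imp fun _ m'' h => ⟨h.1, fun j hj => ?_⟩
  by_cases hji : j = i
  · exact hji ▸ h.2.1
  · exact h.2.2 j hji (hm'.2 j (by simpa [hji] using hj))

end Does

end Prog

/-! ### Solving the LPN problem -/

/-- The character `b ↦ (-1) ^ b` of `𝔽₂`. -/
def sgn : AddChar (ZMod 2) ℝ :=
  AddChar.zmodChar 2 neg_one_sq

theorem sgn_apply (b : ZMod 2) : sgn b = (-1) ^ b.val :=
  AddChar.zmodChar_apply neg_one_sq b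

@[simp]
theorem sgn_one : sgn 1 = -1 := by
  simp [sgn_apply, ZMod.val_one]

theorem sum_zmod_two (f : ZMod 2 → ℝ) : ∑ b, f b = f 0 + f 1 :=
  Fin.sum_univ_two f

theorem zmod_two_eq_zero_or_one (b : ZMod 2) : b = 0 ∨ b = 1 := by
  decide +revert

@[simp]
theorem unbit_bit (b : ZMod 2) : unbit (bit b) = b := by
  rcases zmod_two_eq_zero_or_one b with rfl | rfl <;> simp [bit, unbit]

theorem mem_words {s : ℕ} (x : Word s) : x ∈ words s := by
  simp [words]

theorem nodup_words (s : ℕ) : (words s).Nodup :=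
  Finset.nodup_toList _

@[simp]
theorem length_words (s : ℕ) : (words s).length = 2 ^ s := by
  simp [words, ZMod.card]

/-- The memory `m` holds the samples `smp`. -/
def SamplesLoaded {s N : ℕ} (smp : Fin N → Sample s) (m : Mem s) : Prop :=
  ∀ i : Fin N, (∀ l, m (.smpA i l) = bit ((smp i).1 l)) ∧ m (.smpB i) = bit (smp i).2

/-- The cells that hold `N` samples. -/
def sampleCells (s N : ℕ) : Set (Cell s) :=
  Set.range (fun q : Fin N × Fin s => .smpA q.1 q.2) ∪ Set.range fun i : Fin N => .smpB i

/-- The cells of the three vectors indexed by words. -/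
def wordCells (s : ℕ) : Set (Cell s) :=
  Set.range .num ∪ Set.range .den ∪ Set.range .tab

theorem smpA_mem_sampleCells {s N : ℕ} (i : Fin N) (l : Fin s) :
    .smpA i l ∈ sampleCells s N :=
  .inl ⟨(i, l), rfl⟩

theorem smpB_mem_sampleCells {s N : ℕ} (i : Fin N) : .smpB i ∈ sampleCells s N :=
  .inr ⟨i, rfl⟩

section Solve

variable {s N : ℕ} {δ : ℝ} {smp : Fin N → Sample s} {m : Mem s} {W : Set (Cell s)}

theorem num_mem_of_wordCells_subset (hW : wordCells s ⊆ W) (x : Word s) : .num x ∈ W :=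
  hW (.inl (.inl ⟨x, rfl⟩))

theorem den_mem_of_wordCells_subset (hW : wordCells s ⊆ W) (x : Word s) : .den x ∈ W :=
  hW (.inl (.inr ⟨x, rfl⟩))

theorem tab_mem_of_wordCells_subset (hW : wordCells s ⊆ W) (x : Word s) : .tab x ∈ W :=
  hW (.inr ⟨x, rfl⟩)

theorem load_does (smp : Fin N → Sample s) (m : Mem s) :
    Does (load smp) m (N * (s * 3 + 3)) (sampleCells s N) fun _ => SamplesLoaded smp := by
  have loop := Does.forEach_forall (m := m) (l := List.finRange N) (T := s * 3 + 2)
    (W := sampleCells s N) (fun _ => True)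
    (fun i m => (∀ l, m (.smpA i l) = bit ((smp i).1 l)) ∧ m (.smpB i) = bit (smp i).2)
    (body := fun i : Fin N => do
      forEach (List.finRange s) fun l => wr (.smpA i l) (bit ((smp i).1 l))
      wr (.smpB i) (bit (smp i).2)) (fun i m _ => ?_) trivial
  · rw [List.length_finRange] at loop
    exact loop.imp fun _ _ h i => h.2 i (List.mem_finRange i)
  have bits := Does.forEach_forall (m := m) (l := List.finRange s) (T := 2) (W := sampleCells s N)
    (fun m' => ∀ j ≠ (i : ℕ), (∀ l, m' (.smpA j l) = m (.smpA j l)) ∧ m' (.smpB j) = m (.smpB j))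
    (fun l m => m (.smpA i l) = bit ((smp i).1 l))
    (body := fun l => wr (.smpA i l) (bit ((smp i).1 l)))
    (fun l m' hm' => .wr (smpA_mem_sampleCells i l) (by simp +contextual [hm']))
    (by simp)
  rw [List.length_finRange] at bits
  refine bits.bind fun _ m' hm' => .wr (smpB_mem_sampleCells i)
    ⟨trivial, by simp [hm'.2], fun j hji hj => ?_⟩
  have hji' : (j : ℕ) ≠ i := Fin.val_ne_of_ne hji
  simpa [Function.update_apply, hji', hm'.1 j hji'] using hj

theorem readWord_does (hm : SamplesLoaded smp m) (hW : sampleCells s N ⊆ W) (i : Fin N) :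
    Does (readWord i) m (s * 3) W fun a m' => a = (smp i).1 ∧ m' = m := by
  have loop := Does.loop (m := m) (l := List.finRange s) (T := 2) (W := W)
    (fun done a m' => (∀ l ∈ done, a l = (smp i).1 l) ∧ m' = m)
    (body := fun l a => do
      let v ← rd (.smpA i l)
      op (Function.update a l (unbit v))) (b := (0 : Word s)) ?_ (by simp)
  · rw [List.length_finRange] at loop
    exact loop.imp fun a m' h => ⟨funext fun l => h.1 l (List.mem_finRange l), h.2⟩
  rintro done l rest - a m' ⟨ha, rfl⟩
  refine .rd_bind (hW (smpA_mem_sampleCells i l)) (.op ⟨fun l' hl' => ?_, rfl⟩)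
  by_cases h : l' = l
  · subst h
    simp [(hm i).1]
  · simpa [h] using ha l' (by simpa [h] using hl')

theorem llr_eq_log (δ : ℝ) (smp : Fin N → Sample s) (x : Word s) :
    llr δ smp x = Real.log ((1 - pOne δ smp x) / pOne δ smp x) := by
  unfold llr
  split_ifs with h
  · rfl
  · have no_sample : (Finset.univ.filter fun i => (smp i).1 = x) = ∅ :=
      Finset.filter_eq_empty_iff.2 fun i _ hi => h ⟨i, hi⟩
    simp only [pOne, no_sample, Finset.prod_empty]
    norm_num

/-- The loop of `buildTable` which sets the products `∏ p'ᵢ` and `∏ (1 - p'ᵢ)` of all words to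
`1`. -/
def initProducts (s : ℕ) : Prog s Unit :=
  forEach (words s) fun x => do
    wr (.num x) 1
    wr (.den x) 1

/-- The loop of `buildTable` which multiplies the factors of each sample into the products. -/
def multiplyProducts (s N : ℕ) (δ : ℝ) : Prog s Unit :=
  forEach (List.finRange N) fun i => do
    let a ← readWord i
    let b ← rd (.smpB i)
    let p ← op (pFlip δ (unbit b))
    let v ← rd (.num a)
    wr (.num a) (v * p)
    let q ← op (1 - p)
    let v' ← rd (.den a)
    wr (.den a) (v' * q)

/-- The loop of `buildTable` which computes the vector `f` from the products. -/
def writeLogRatios (s : ℕ) : Prog s Unit :=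
  forEach (words s) fun x => do
    let v ← rd (.num x)
    let v' ← rd (.den x)
    let d ← op (v + v')
    let p ← op (v / d)
    let q ← op (1 - p)
    let r ← op (q / p)
    wr (.tab x) (Real.log r)

theorem buildTable_eq (s N : ℕ) (δ : ℝ) :
    buildTable s N δ =
      initProducts s >>= fun _ => multiplyProducts s N δ >>= fun _ => writeLogRatios s :=
  rfl

theorem initProducts_does (hm : SamplesLoaded smp m) (hW : wordCells s ⊆ W) :
    Does (initProducts s) m (2 ^ s * 5) W fun _ m' =>
      SamplesLoaded smp m' ∧ ∀ x, m' (.num x) = 1 ∧ m' (.den x) = 1 := by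
  have loop := Does.forEach_forall (m := m) (l := words s) (T := 4) (W := W) (SamplesLoaded smp)
    (fun x m => m (.num x) = 1 ∧ m (.den x) = 1)
    (body := fun x => do
      wr (.num x) 1
      wr (.den x) 1) (fun x m hm => ?_) hm
  · rw [length_words] at loop
    exact loop.imp fun _ _ h => ⟨h.1, fun x => h.2 x (mem_words x)⟩
  refine .wr_bind (num_mem_of_wordCells_subset hW x) (.wr (den_mem_of_wordCells_subset hW x)
    ⟨?_, by simp, fun y hy => by simp [hy]⟩)
  simpa [SamplesLoaded] using hm

theorem multiplyProducts_does (δ : ℝ) (hm : SamplesLoaded smp m)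
    (hone : ∀ x, m (.num x) = 1 ∧ m (.den x) = 1) (hW : wordCells s ⊆ W)
    (hW' : sampleCells s N ⊆ W) :
    Does (multiplyProducts s N δ) m (N * (s * 3 + 10)) W fun _ m' =>
      ∀ x, m' (.num x) = ∏ i with (smp i).1 = x, pFlip δ (smp i).2 ∧
        m' (.den x) = ∏ i with (smp i).1 = x, (1 - pFlip δ (smp i).2) := by
  have loop := Does.forEach (m := m) (l := List.finRange N) (T := s * 3 + 9) (W := W)
    (fun done m => SamplesLoaded smp m ∧ ∀ x,
      m (.num x) = (done.map fun i => if (smp i).1 = x then pFlip δ (smp i).2 else 1).prod ∧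
      m (.den x) = (done.map fun i => if (smp i).1 = x then 1 - pFlip δ (smp i).2 else 1).prod)
    (body := fun i => do
      let a ← readWord i
      let b ← rd (.smpB i)
      let p ← op (pFlip δ (unbit b))
      let v ← rd (.num a)
      wr (.num a) (v * p)
      let q ← op (1 - p)
      let v' ← rd (.den a)
      wr (.den a) (v' * q)) ?_ ⟨hm, by simpa using hone⟩
  · rw [List.length_finRange] at loop
    refine loop.imp fun _ m' h x => ?_
    simpa only [Finset.prod_filter, Fin.prod_univ_def] using h.2 x
  rintro done i rest - m ⟨hm, hprod⟩
  refine (readWord_does hm hW' i).bind (T₂ := 9) ?_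
  rintro a m' ⟨rfl, rfl⟩
  refine .rd_bind (hW' (smpB_mem_sampleCells i)) (.op_bind
    (.rd_bind (num_mem_of_wordCells_subset hW _) (.wr_bind (num_mem_of_wordCells_subset hW _)
    (.op_bind (.rd_bind (den_mem_of_wordCells_subset hW _)
    (.wr (den_mem_of_wordCells_subset hW _) ⟨?_, fun x => ?_⟩))))))
  · simpa [SamplesLoaded] using hm
  · rw [(hm i).2, unbit_bit]
    by_cases h : x = (smp i).1
    · simp [h, hprod (smp i).1]
    · simp [h, Ne.symm h, hprod x]

theorem writeLogRatios_does (hnum : ∀ x, m (.num x) = ∏ i with (smp i).1 = x, pFlip δ (smp i).2)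
    (hden : ∀ x, m (.den x) = ∏ i with (smp i).1 = x, (1 - pFlip δ (smp i).2))
    (hW : wordCells s ⊆ W) :
    Does (writeLogRatios s) m (2 ^ s * 9) W fun _ m' => ∀ x, m' (.tab x) = llr δ smp x := by
  have loop := Does.forEach_forall (m := m) (l := words s) (T := 8) (W := W)
    (fun m => (∀ x, m (.num x) = ∏ i with (smp i).1 = x, pFlip δ (smp i).2) ∧
      ∀ x, m (.den x) = ∏ i with (smp i).1 = x, (1 - pFlip δ (smp i).2))
    (fun x m => m (.tab x) = llr δ smp x)
    (body := fun x => do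
      let v ← rd (.num x)
      let v' ← rd (.den x)
      let d ← op (v + v')
      let p ← op (v / d)
      let q ← op (1 - p)
      let r ← op (q / p)
      wr (.tab x) (Real.log r)) (fun x m hm => ?_) ⟨hnum, hden⟩
  · rw [length_words] at loop
    exact loop.imp fun _ _ h x => h.2 x (mem_words x)
  classical
  refine .rd_bind (num_mem_of_wordCells_subset hW _) (.rd_bind (den_mem_of_wordCells_subset hW _)
    (.op_bind (.op_bind (.op_bind (.op_bind
    (.wr (tab_mem_of_wordCells_subset hW _) ⟨by simpa using hm, ?_, fun y hy => by simp [hy]⟩))))))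
  rw [Function.update_self, hm.1, hm.2, llr_eq_log]
  rfl

theorem buildTable_does (δ : ℝ) (hm : SamplesLoaded smp m) (hW : wordCells s ⊆ W)
    (hW' : sampleCells s N ⊆ W) :
    Does (buildTable s N δ) m (2 ^ s * 5 + (N * (s * 3 + 10) + 2 ^ s * 9)) W
      fun _ m' => ∀ x, m' (.tab x) = llr δ smp x := by
  rw [buildTable_eq]
  exact (initProducts_does hm hW).bind fun _ _ ⟨hm, hone⟩ =>
    (multiplyProducts_does δ hm hone hW hW').bind fun _ _ hprod =>
      writeLogRatios_does (fun x => (hprod x).1) (fun x => (hprod x).2) hW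

end Solve

/-! ### The fast Fourier transform -/

/-- The kernel of the Fourier transform with respect to the coordinates in `D` only. -/
def partialKernel {s : ℕ} (D : Finset (Fin s)) (x y : Word s) : ℝ :=
  ∏ l, if l ∈ D then sgn (x l * y l) else if x l = y l then 1 else 0

/-- The Fourier transform with respect to the coordinates in `D` only, i.e. the content of `tab`
when `fft` has treated these coordinates. -/
def partialFourier {s : ℕ} (D : Finset (Fin s)) (f : Word s → ℝ) (x : Word s) : ℝ :=
  ∑ y, f y * partialKernel D x y

/-- The Fourier transform with respect to the coordinate `l` only. -/
def butterfly {s : ℕ} (l : Fin s) (g : Word s → ℝ) (x : Word s) : ℝ :=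
  g (Function.update x l 0) + sgn (x l) * g (Function.update x l 1)

/-- The pass of `fft` for the coordinate `l`. -/
def fftPass {s : ℕ} (l : Fin s) : Prog s Unit :=
  forEach (words s) fun x =>
    if x l = 0 then do
      let x' ← op (Function.update x l 1)
      let v ← rd (.tab x)
      let v' ← rd (.tab x')
      wr (.tab x) (v + v')
      wr (.tab x') (v - v')
    else op ()

section FastFourierTransform

variable {s : ℕ} {m : Mem s} {W : Set (Cell s)}

theorem fourier_eq (f : Word s → ℝ) (x : Word s) :
    fourier f x = ∑ a, f a * sgn (dotProduct x a) := by
  simp only [fourier, sgn_apply]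

theorem sgn_sum {ι : Type*} (S : Finset ι) (b : ι → ZMod 2) :
    sgn (∑ i ∈ S, b i) = ∏ i ∈ S, sgn (b i) :=
  map_prod sgn.toMonoidHom (fun i => Multiplicative.ofAdd (b i)) S

theorem partialFourier_empty (f : Word s → ℝ) : partialFourier ∅ f = f := by
  have kernel (x y : Word s) : partialKernel ∅ x y = if x = y then 1 else 0 := by
    simp only [partialKernel, Finset.notMem_empty, if_false, Finset.prod_ite_zero, funext_iff,
      Finset.mem_univ, true_imp_iff, Finset.prod_const_one]
  funext x
  simp [partialFourier, kernel]

theorem partialFourier_univ (f : Word s → ℝ) : partialFourier Finset.univ f = fourier f := by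
  funext x
  simp only [partialFourier, partialKernel, fourier_eq, Finset.mem_univ, if_true, dotProduct,
    sgn_sum]

theorem partialKernel_insert {D : Finset (Fin s)} {l : Fin s} (hl : l ∉ D) (x y : Word s) :
    partialKernel (insert l D) x y = partialKernel D (Function.update x l 0) y +
      sgn (x l) * partialKernel D (Function.update x l 1) y := by
  have off_l (z : Word s) (hz : ∀ l' ≠ l, z l' = x l') (E : Finset (Fin s))
      (hE : ∀ l' ≠ l, l' ∈ E ↔ l' ∈ D) :
      partialKernel E z y = (if l ∈ E then sgn (z l * y l) else if z l = y l then 1 else 0) *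
        ∏ l' ∈ Finset.univ.erase l,
          if l' ∈ D then sgn (x l' * y l') else if x l' = y l' then 1 else 0 := by
    rw [partialKernel, ← Finset.mul_prod_erase _ _ (Finset.mem_univ l)]
    congr 1
    refine Finset.prod_congr rfl fun l' hl' => ?_
    have hne := Finset.ne_of_mem_erase hl'
    simp only [hz l' hne, hE l' hne]
  rw [off_l x (fun _ _ => rfl) _ fun l' h => by simp [h],
    off_l (Function.update x l 0) (fun l' h => by simp [h]) D fun _ _ => Iff.rfl,
    off_l (Function.update x l 1) (fun l' h => by simp [h]) D fun _ _ => Iff.rfl,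
    ← mul_assoc, ← add_mul]
  congr 1
  rcases zmod_two_eq_zero_or_one (y l) with hy | hy <;> simp [hl, hy]

theorem partialFourier_insert {D : Finset (Fin s)} {l : Fin s} (hl : l ∉ D) (f : Word s → ℝ) :
    partialFourier (insert l D) f = butterfly l (partialFourier D f) := by
  funext x
  simp only [butterfly, partialFourier, partialKernel_insert hl, Finset.mul_sum,
    ← Finset.sum_add_distrib]
  exact Finset.sum_congr rfl fun y _ => by ring

theorem butterfly_of_eq_zero {l : Fin s} {x : Word s} (hx : x l = 0) (g : Word s → ℝ) :
    butterfly l g x = g x + g (Function.update x l 1) := by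
  have : Function.update x l 0 = x := by rw [← hx, Function.update_eq_self]
  simp [butterfly, this, hx]

theorem butterfly_update_one (l : Fin s) {x : Word s} (hx : x l = 0) (g : Word s → ℝ) :
    butterfly l g (Function.update x l 1) = g x - g (Function.update x l 1) := by
  have : Function.update x l 0 = x := by rw [← hx, Function.update_eq_self]
  simp [butterfly, this, sub_eq_add_neg]

theorem update_one_apart {l : Fin s} {x y : Word s} (hx : x l = 0) (hy : y l = 0) (hyx : y ≠ x) :
    y ≠ Function.update x l 1 ∧ Function.update y l 1 ≠ x ∧
      Function.update y l 1 ≠ Function.update x l 1 := by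
  refine ⟨fun h => ?_, fun h => ?_, fun h => hyx ?_⟩
  · simpa [hy] using congrFun h l
  · simpa [hx] using congrFun h l
  · funext l'
    rcases eq_or_ne l' l with rfl | hl'
    · rw [hy, hx]
    · simpa [hl'] using congrFun h l'

theorem fftPass_does (l : Fin s) (g : Word s → ℝ) (hW : wordCells s ⊆ W)
    (hm : ∀ x, m (.tab x) = g x) :
    Does (fftPass l) m (2 ^ s * 8) W fun _ m' => ∀ x, m' (.tab x) = butterfly l g x := by
  have tab_mem := tab_mem_of_wordCells_subset hW
  have loop := Does.forEach_of_nodup (m := m) (T := 7) (W := W) (nodup_words s)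
    (fun x m => x l = 0 → m (.tab x) = g x ∧
      m (.tab (Function.update x l 1)) = g (Function.update x l 1))
    (fun x m => x l = 0 → m (.tab x) = butterfly l g x ∧
      m (.tab (Function.update x l 1)) = butterfly l g (Function.update x l 1))
    (body := fun x =>
      if x l = 0 then do
        let x' ← op (Function.update x l 1)
        let v ← rd (.tab x)
        let v' ← rd (.tab x')
        wr (.tab x) (v + v')
        wr (.tab x') (v - v')
      else op ()) (fun x m hm => ?_) fun x _ => ⟨hm x, hm _⟩
  · rw [length_words] at loop
    refine loop.imp fun _ m' h x => ?_
    have hx := h (Function.update x l 0) (mem_words _) (by simp)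
    rw [Function.update_idem] at hx
    rcases zmod_two_eq_zero_or_one (x l) with h0 | h1
    · simpa [← h0] using hx.1
    · simpa [← h1] using hx.2
  by_cases hx : x l = 0
  · rw [if_pos hx]
    have hxx' : x ≠ Function.update x l 1 := fun h => by simpa [hx] using congrFun h l
    refine .op_bind (.rd_bind (tab_mem _) (.rd_bind (tab_mem _)
      (.wr_bind (tab_mem _) (.wr (tab_mem _) ⟨fun _ => ?_, fun y hyx => ?_⟩))))
    · simp [hxx', hm hx, butterfly_of_eq_zero hx, butterfly_update_one l hx]
    · constructor <;> intro h hy <;>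
        simpa [hyx, update_one_apart hx hy hyx] using h hy
  · rw [if_neg hx]
    exact (Does.op ⟨fun h => absurd h hx, fun _ _ => ⟨id, id⟩⟩).weaken (by norm_num) subset_rfl

theorem fft_does (f : Word s → ℝ) (hW : wordCells s ⊆ W) (hm : ∀ x, m (.tab x) = f x) :
    Does (fft s) m (s * (2 ^ s * 8 + 1)) W fun _ m' => ∀ x, m' (.tab x) = fourier f x := by
  have passes := Does.forEach (m := m) (l := List.finRange s) (T := 2 ^ s * 8) (W := W)
    (body := fftPass) (fun done m => ∀ x, m (.tab x) = partialFourier done.toFinset f x)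
    (fun done l rest hsplit m hm => ?_) (by simpa [partialFourier_empty] using hm)
  · rw [List.length_finRange, List.toFinset_finRange, partialFourier_univ] at passes
    exact passes
  have hl : l ∉ done.toFinset := fun h => List.disjoint_of_nodup_append
    (hsplit ▸ List.nodup_finRange s) (List.mem_toFinset.1 h) List.mem_cons_self
  have insert_l : (done ++ [l]).toFinset = insert l done.toFinset := by
    ext; simp
  rw [insert_l, partialFourier_insert hl]
  exact fftPass_does l _ hW hm

theorem argmax_does (g : Word s → ℝ) (hW : wordCells s ⊆ W) (hm : ∀ x, m (.tab x) = g x) :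
    Does (argmax s) m (2 ^ s * 3 + 1) W fun best _ =>
      List.argmax g (0 :: words s) = some best.1 ∧ best.2 = g best.1 := by
  refine .rd_bind (tab_mem_of_wordCells_subset hW 0) ?_
  have loop := Does.loop (m := m) (l := words s) (T := 2) (W := W)
    (body := fun x best => do
      let v ← rd (.tab x)
      op (if best.2 < v then (x, v) else best)) (b := ((0 : Word s), g 0))
    (fun done best m' => (List.argmax g (0 :: done) = some best.1 ∧ best.2 = g best.1) ∧
      ∀ x, m' (.tab x) = g x) ?_ ⟨⟨rfl, rfl⟩, hm⟩
  · rw [length_words] at loop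
    rw [hm]
    exact loop.imp fun _ _ h => h.1
  rintro done x rest - best m ⟨⟨hbest, hval⟩, hm⟩
  refine .rd_bind (tab_mem_of_wordCells_subset hW x) (.op ⟨?_, hm⟩)
  rw [← List.cons_append, List.argmax_concat, hbest, hm, hval]
  by_cases h : g best.1 < g x <;> simp [h, hval]

end FastFourierTransform

section Solve

variable {s N : ℕ} {δ : ℝ} {smp : Fin N → Sample s} {m : Mem s}

/-- What `solve` returns on given samples. -/
def solveVal (δ : ℝ) (smp : Fin N → Sample s) : Option (Word s) :=
  (List.argmax (fourier (llr δ smp)) (0 :: words s)).filter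
    fun x => threshold δ N ≤ fourier (llr δ smp) x

theorem iterSpec_solveVal (δ : ℝ) (smp : Fin N → Sample s) : IterSpec δ smp (solveVal δ smp) := by
  obtain ⟨x₀, hx₀⟩ : ∃ x₀, List.argmax (fourier (llr δ smp)) (0 :: words s) = some x₀ :=
    Option.ne_none_iff_exists'.1 (by simp [List.argmax_eq_none])
  have is_max (x : Word s) : fourier (llr δ smp) x ≤ fourier (llr δ smp) x₀ :=
    List.le_of_mem_argmax (List.mem_cons_of_mem _ (mem_words x)) hx₀
  rw [solveVal, hx₀, Option.filter_some]
  by_cases h : threshold δ N ≤ fourier (llr δ smp) x₀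
  · exact .inr ⟨x₀, by simp [h], is_max, h⟩
  · exact .inl ⟨by simp [h], fun x => (is_max x).trans_lt (not_le.1 h)⟩

/-- The bound for the number of steps of `solve` on `N` samples. -/
def solveTime (s N : ℕ) : ℕ :=
  2 ^ s * 5 + (N * (s * 3 + 10) + 2 ^ s * 9) + (s * (2 ^ s * 8 + 1) + (2 ^ s * 3 + 2))

theorem solve_does (δ : ℝ) (hm : SamplesLoaded smp m) :
    Does (solve s N δ) m (solveTime s N) (sampleCells s N ∪ wordCells s)
      fun r _ => r = solveVal δ smp := by
  have hW : wordCells s ⊆ sampleCells s N ∪ wordCells s := Set.subset_union_right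
  refine (buildTable_does δ hm hW Set.subset_union_left).bind fun _ m htab =>
    (fft_does _ hW htab).bind fun _ m hfourier => (argmax_does _ hW hfourier).bind
      fun best m ⟨hbest, hval⟩ => .op ?_
  simp [solveVal, hbest, hval, Option.filter_some]

theorem iterSpec_load_solve (δ : ℝ) (smp : Fin N → Sample s) (m : Mem s) :
    IterSpec δ smp ((load smp >>= fun _ => solve s N δ).run m).1 := by
  have does := ((load_does smp m).weaken le_rfl Set.subset_union_left).bind
    fun _ m hm => solve_does δ hm
  rw [does.post]
  exact iterSpec_solveVal δ smp

end Solve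

/-! ### The samples computed by an iteration -/

/-- The loop of `source` which writes the set of positions. -/
def writePos {n s : ℕ} (P : Pos n s) : Prog s Unit :=
  forEach (List.finRange s) fun l => wr (.pos l) ((position P l : ℕ) : ℝ)

/-- The loop of `source` which writes the vector `h_𝒫` of the sample number `i`. -/
def writeRestriction (s i : ℕ) : Prog s Unit :=
  forEach (List.finRange s) fun l => do
    let v ← rd (.pos l)
    let h ← rd (.chk i ⌊v⌋₊)
    wr (.smpA i l) h

/-- The loop of `source` which computes `⟨y, h⟩` for the parity-check `h` number `i`. -/
def mulReceived (n s i : ℕ) : Prog s (ZMod 2) :=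
  loop (List.finRange n) (fun j b => do
    let h ← rd (.chk i (j : ℕ))
    let v ← rd (.inp (j : ℕ))
    op (b + unbit h * unbit v)) 0

/-- The part of `source` which comes after the call of `create`. -/
def writeSamples (n s N : ℕ) : Prog s Unit :=
  forEach (List.finRange N) fun i => do
    writeRestriction s i
    let b ← mulReceived n s i
    wr (.smpB i) (bit b)

/-- The cells of the set of positions and of the received word. -/
def inputCells (n s : ℕ) : Set (Cell s) :=
  Set.range (fun l : Fin s => .pos l) ∪ Set.range fun j : Fin n => .inp j

section Source

variable {n m s N w Teq : ℕ} {y : Fin n → ZMod 2} {H : Matrix (Fin m) (Fin n) (ZMod 2)}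
  {P : Pos n s} {M M' : Mem s} {V : Set (Cell s)} {W : Finset (Cell s)} {create : Prog s Unit}

theorem source_eq (N : ℕ) (P : Pos n s) (create : Prog s Unit) :
    source N P create = (forEach (List.finRange n) fun _ => op ()) >>= fun _ =>
      writePos P >>= fun _ => create >>= fun _ => writeSamples n s N :=
  rfl

theorem InputLoaded.of_eqOn {S : Set (Cell s)} (hM : InputLoaded y H M) (h : Set.EqOn M' M S)
    (hinp : ∀ j, .inp j ∈ S) (hmat : ∀ i j, .mat i j ∈ S) : InputLoaded y H M' :=
  ⟨fun j => (h (hinp j)).trans (hM.1 j), fun i j => (h (hmat i j)).trans (hM.2 i j)⟩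

theorem pos_mem_inputCells (l : Fin s) : .pos l ∈ inputCells n s :=
  .inl ⟨l, rfl⟩

theorem inp_mem_inputCells (j : Fin n) : .inp j ∈ inputCells n s :=
  .inr ⟨j, rfl⟩

theorem writePos_does (P : Pos n s) (M : Mem s) :
    Does (writePos P) M (s * 3) (Set.range fun l : Fin s => .pos l) fun _ => PosLoaded P := by
  have loop := Does.forEach_forall (m := M) (l := List.finRange s) (T := 2)
    (W := Set.range fun l : Fin s => .pos l) (fun _ => True)
    (fun l M => M (.pos l) = ((position P l : ℕ) : ℝ))
    (body := fun l => wr (.pos l) ((position P l : ℕ) : ℝ))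
    (fun l M _ => .wr ⟨l, rfl⟩ ⟨trivial, by simp, fun l' hl' => ?_⟩) trivial
  · rw [List.length_finRange] at loop
    exact loop.imp fun _ _ h l => h.2 l (List.mem_finRange l)
  simp [Fin.val_ne_of_ne hl']

theorem writeRestriction_does {i : ℕ} {h : Fin n → ZMod 2} (hpos : PosLoaded P M)
    (hchk : ∀ j : Fin n, M (.chk i j) = bit (h j)) (hposV : ∀ l : Fin s, .pos l ∈ V)
    (hchkV : ∀ j : Fin n, .chk i j ∈ V) (hsmpV : ∀ l, .smpA i l ∈ V) :
    Does (writeRestriction s i) M (s * 5) V fun _ M' =>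
      Set.EqOn M' M (Set.range (.smpA i))ᶜ ∧ ∀ l, M' (.smpA i l) = bit (onP P h l) := by
  have loop := Does.forEach_forall (m := M) (l := List.finRange s) (T := 4) (W := V)
    (fun M' => Set.EqOn M' M (Set.range (.smpA i))ᶜ)
    (fun l M' => M' (.smpA i l) = bit (onP P h l))
    (body := fun l => do
      let v ← rd (.pos l)
      let h ← rd (.chk i ⌊v⌋₊)
      wr (.smpA i l) h) (fun l M' hM' => ?_) (Set.eqOn_refl _ _)
  · rw [List.length_finRange] at loop
    exact loop.imp fun _ _ h => ⟨h.1, fun l => h.2 l (List.mem_finRange l)⟩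
  have pos_eq : M' (.pos l) = ((position P l : ℕ) : ℝ) := (hM' (by simp)).trans (hpos l)
  have chk_eq (j : Fin n) : M' (.chk i j) = bit (h j) := (hM' (by simp)).trans (hchk j)
  classical
  refine .rd_bind (hposV l) ?_
  rw [pos_eq, Nat.floor_natCast]
  refine .rd_bind (hchkV _) (.wr (hsmpV l) ⟨fun c hc => ?_, ?_, fun l' hl' => by simp [hl']⟩)
  · rw [Function.update_of_ne (fun h => hc ⟨l, h.symm⟩), hM' hc]
  · rw [Function.update_self, chk_eq]
    rfl

theorem mulReceived_does {i : ℕ} {h : Fin n → ZMod 2}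
    (hinp : ∀ j : Fin n, M (.inp j) = bit (y j)) (hchk : ∀ j : Fin n, M (.chk i j) = bit (h j))
    (hinpV : ∀ j : Fin n, .inp j ∈ V) (hchkV : ∀ j : Fin n, .chk i j ∈ V) :
    Does (mulReceived n s i) M (n * 4) V fun b M' => b = ∑ j, h j * y j ∧ M' = M := by
  have loop := Does.loop (m := M) (l := List.finRange n) (T := 3) (W := V)
    (fun done b M' => b = (done.map fun j => h j * y j).sum ∧ M' = M)
    (body := fun j b => do
      let h ← rd (.chk i (j : ℕ))
      let v ← rd (.inp (j : ℕ))
      op (b + unbit h * unbit v)) (b := (0 : ZMod 2)) ?_ (by simp)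
  · rw [List.length_finRange] at loop
    simp only [Fin.sum_univ_def]
    exact loop
  rintro done j - - b M' ⟨rfl, rfl⟩
  exact .rd_bind (hchkV j) (.rd_bind (hinpV j) (.op ⟨by simp [hchk, hinp], rfl⟩))

theorem writeSamples_does {h : Fin N → Fin n → ZMod 2}
    (hinp : ∀ j : Fin n, M (.inp j) = bit (y j)) (hpos : PosLoaded P M) (hchk : ChecksLoaded h M)
    (hinV : inputCells n s ⊆ V) (hsmpV : sampleCells s N ⊆ V)
    (hchkV : ∀ (i : Fin N) (j : Fin n), Cell.chk (i : ℕ) (j : ℕ) ∈ V) :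
    Does (writeSamples n s N) M (N * (s * 5 + (n * 4 + 2) + 1)) V fun _ M' =>
      Set.EqOn M' M (sampleCells s N)ᶜ ∧
        SamplesLoaded (fun i => (onP P (h i), ∑ j, h i j * y j)) M' := by
  have loop := Does.forEach_forall (m := M) (l := List.finRange N) (T := s * 5 + (n * 4 + 2))
    (W := V) (fun M' => Set.EqOn M' M (sampleCells s N)ᶜ)
    (fun i M' => (∀ l, M' (.smpA i l) = bit (onP P (h i) l)) ∧
      M' (.smpB i) = bit (∑ j, h i j * y j))
    (body := fun i : Fin N => do
      writeRestriction s i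
      let b ← mulReceived n s i
      wr (.smpB i) (bit b)) (fun i M₁ hM₁ => ?_) (Set.eqOn_refl _ _)
  · rw [List.length_finRange] at loop
    exact loop.imp fun _ _ h => ⟨h.1, fun i => h.2 i (List.mem_finRange i)⟩
  have hpos₁ : PosLoaded P M₁ := fun l => (hM₁ (by simp [sampleCells])).trans (hpos l)
  have hchk₁ (j : Fin n) : M₁ (.chk i j) = bit (h i j) :=
    (hM₁ (by simp [sampleCells])).trans (hchk i j)
  have hinp₁ (j : Fin n) : M₁ (.inp j) = bit (y j) :=
    (hM₁ (by simp [sampleCells])).trans (hinp j)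
  classical
  refine (writeRestriction_does hpos₁ hchk₁ (fun l => hinV (pos_mem_inputCells l)) (hchkV i)
    fun l => hsmpV (smpA_mem_sampleCells i l)).bind fun _ M₂ ⟨hM₂, ha⟩ => ?_
  refine (mulReceived_does (fun j => (hM₂ (by simp)).trans (hinp₁ j))
    (fun j => (hM₂ (by simp)).trans (hchk₁ j)) (fun j => hinV (inp_mem_inputCells j))
    (hchkV i)).bind fun b M₃ hb => ?_
  obtain ⟨rfl, rfl⟩ := hb
  refine .wr (hsmpV (smpB_mem_sampleCells i))
    ⟨fun c hc => ?_, ⟨fun l => by simp [ha], by simp⟩, fun i' hi' hdone => ?_⟩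
  · rw [Function.update_of_ne (ne_of_mem_of_not_mem (smpB_mem_sampleCells i) hc).symm, hM₂, hM₁ hc]
    rintro ⟨l, rfl⟩
    exact hc (smpA_mem_sampleCells i l)
  · have hne : (i' : ℕ) ≠ i := Fin.val_ne_of_ne hi'
    have smpA_eq (l : Fin s) : M₃ (.smpA i' l) = M₁ (.smpA i' l) := hM₂ (by simp [hne.symm])
    have smpB_eq : M₃ (.smpB i') = M₁ (.smpB i') := hM₂ (by simp)
    simpa [hne, smpA_eq, smpB_eq] using hdone

theorem IsCreate.does (hcr : IsCreate y H N w Teq W P create) (hin : InputLoaded y H M)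
    (hpos : PosLoaded P M) :
    Does create M Teq W fun _ M' => InputLoaded y H M' ∧ PosLoaded P M' ∧
      ∃ h : Fin N → Fin n → ZMod 2, AreChecks (code H) w P h ∧ ChecksLoaded h M' := by
  obtain ⟨htime, hcells, -, hpost⟩ := hcr M hin hpos
  exact ⟨hpost, htime, Finset.coe_subset.2 hcells⟩

theorem IsCreate.chk_mem_cells (hcr : IsCreate y H N w Teq W P create) (hin : InputLoaded y H M)
    (hpos : PosLoaded P M) (i : Fin N) (j : Fin n) :
    Cell.chk (i : ℕ) (j : ℕ) ∈ create.cells M :=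
  (hcr M hin hpos).2.2.1 i j

/-- The bound for the number of steps of `source`, without the call of `create`. -/
def sourceTime (n s N : ℕ) : ℕ := n * 2 + s * 3 + N * (s * 5 + (n * 4 + 2) + 1)

theorem source_does (hin : InputLoaded y H M) (hcr : IsCreate y H N w Teq W P create) :
    Does (source N P create) M (sourceTime n s N + Teq) (W ∪ inputCells n s ∪ sampleCells s N)
      fun _ M' => InputLoaded y H M' ∧ ∃ h : Fin N → Fin n → ZMod 2, AreChecks (code H) w P h ∧
        SamplesLoaded (fun i => (onP P (h i), ∑ j, h i j * y j)) M' := by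
  set V : Set (Cell s) := W ∪ inputCells n s ∪ sampleCells s N
  have hWV : ↑W ⊆ V := Set.subset_union_left.trans Set.subset_union_left
  have hinV : inputCells n s ⊆ V := Set.subset_union_right.trans Set.subset_union_left
  have choice : Does (forEach (List.finRange n) fun _ => op ()) M (n * 2) V
      fun _ M' => M' = M := by
    simpa only [List.length_finRange] using Does.forEach (l := List.finRange n) (T := 1) (W := V)
      (fun _ M' => M' = M) (fun _ _ _ _ _ h => .op h) rfl
  rw [source_eq]
  refine Does.weaken (T := n * 2 + (s * 3 + (Teq + N * (s * 5 + (n * 4 + 2) + 1)))) ?_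
    (by unfold sourceTime; omega) subset_rfl
  refine choice.bind fun _ M₀ hM₀ => ?_
  subst hM₀
  refine ((writePos_does P M₀).frame.weaken le_rfl (Set.subset_union_left.trans hinV)).bind
    fun _ M₁ ⟨hpos, hM₁⟩ => ?_
  have hin₁ : InputLoaded y H M₁ := hin.of_eqOn hM₁ (by simp) (by simp)
  refine ((hcr.does hin₁ hpos).weaken le_rfl hWV).bind
    fun _ M₂ ⟨hin₂, hpos₂, h, hh, hchk⟩ => ?_
  have hchkV (i : Fin N) (j : Fin n) : Cell.chk (i : ℕ) (j : ℕ) ∈ V :=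
    hWV ((hcr M₁ hin₁ hpos).2.1 (hcr.chk_mem_cells hin₁ hpos i j))
  exact (writeSamples_does hin₂.1 hpos₂ hchk hinV Set.subset_union_right hchkV).imp
    fun _ M₃ ⟨hM₃, hsmp⟩ =>
      ⟨hin₂.of_eqOn hM₃ (by simp [sampleCells]) (by simp [sampleCells]), h, hh, hsmp⟩

theorem sum_position (P : Pos n s) (g : Fin n → ZMod 2) :
    ∑ l, g (position P l) = ∑ j ∈ P.1, g j := by
  rw [← Finset.map_orderEmbOfFin_univ P.1 P.2, Finset.sum_map]
  rfl

theorem sum_mul_received (P : Pos n s) {c : Fin n → ZMod 2} (hc : c ∈ code H)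
    (e : Fin n → ZMod 2) {h : Fin n → ZMod 2} (hh : h ∈ dual (code H)) :
    ∑ j, h j * (c + e) j = dotProduct (onP P e) (onP P h) + dotN P e h := by
  have orthogonal : ∑ j, h j * c j = 0 := by
    simpa only [dotProduct, mul_comm] using hh c hc
  have on_P : dotProduct (onP P e) (onP P h) = ∑ j ∈ P.1, e j * h j :=
    sum_position P fun j => e j * h j
  simp only [Pi.add_apply, mul_add, Finset.sum_add_distrib, orthogonal, zero_add]
  simp only [on_P, dotN, Finset.sum_add_sum_compl, mul_comm (h _)]

theorem samples_eq_lpnSamples {c : Fin n → ZMod 2} (hc : c ∈ code H) (e : Fin n → ZMod 2)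
    {h : Fin N → Fin n → ZMod 2} (hh : AreChecks (code H) w P h) :
    (fun i => (onP P (h i), ∑ j, h i j * (c + e) j)) =
      lpnSamples (onP P e) (fun i => onP P (h i)) fun i => dotN P e (h i) := by
  funext i
  have hdual : h i ∈ dual (code H) := by
    have := hh.2 i
    simp only [checks, Finset.mem_filter] at this
    exact this.2.1
  rw [sum_mul_received P hc e hdual, lpnSamples]

end Source

/-! ### The outer loop -/

/-- The output of the decoder when its iterations work on the given sets and samples. -/
def decoderVal {n s N : ℕ} (δ : ℝ) (l : List (Pos n s × (Fin N → Sample s))) :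
    Option (Pos n s × Word s) :=
  l.findSome? fun q => (solveVal δ q.2).map fun x => (q.1, x)

theorem decoder_cons_does {n s N T T' : ℕ} {δ : ℝ} {P : Pos n s} {src : Prog s Unit}
    {rest : List (Pos n s × Prog s Unit)} {smp : Fin N → Sample s}
    {rest' : List (Pos n s × (Fin N → Sample s))} {M : Mem s} {V : Set (Cell s)}
    (hV : sampleCells s N ∪ wordCells s ⊆ V)
    (hsrc : Does src M T V fun _ M' => SamplesLoaded smp M')
    (hrest : Does (decoder N δ rest) ((solve s N δ).run (src.run M).2).2 T' V
      fun r _ => r = decoderVal δ rest') :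
    Does (decoder N δ ((P, src) :: rest)) M (T + (solveTime s N + (T' + 1))) V
      fun r _ => r = decoderVal δ ((P, smp) :: rest') := by
  have hsolve := (solve_does δ hsrc.post).weaken le_rfl hV
  refine hsrc.run_eq.bind fun _ M₁ h₁ => ?_
  obtain rfl : M₁ = (src.run M).2 := congrArg Prod.snd h₁
  refine hsolve.run_eq.bind fun r M₂ h₂ => ?_
  obtain rfl : M₂ = _ := congrArg Prod.snd h₂
  obtain rfl : r = solveVal δ smp := (congrArg Prod.fst h₂).trans hsolve.post
  rw [decoderVal, List.findSome?_cons]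
  cases solveVal δ smp with
  | some x => exact Does.weaken (T := 1) (W := V) (.op rfl) (Nat.le_add_left 1 T') subset_rfl
  | none => exact hrest.tick

theorem run_decoder_load {n s N : ℕ} (δ : ℝ) (l : List (Pos n s × (Fin N → Sample s))) (M : Mem s) :
    ((decoder N δ (l.map fun q => (q.1, load q.2))).run M).1 = decoderVal δ l := by
  suffices ∃ T, Does (decoder N δ (l.map fun q => (q.1, load q.2))) M T Set.univ
      fun r _ => r = decoderVal δ l from this.choose_spec.post
  induction l generalizing M with
  | nil => exact ⟨0, .ret rfl⟩
  | cons q l ih =>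
    obtain ⟨T, hT⟩ := ih ((solve s N δ).run ((load q.2).run M).2).2
    exact ⟨_, decoder_cons_does (Set.subset_univ _)
      ((load_does q.2 M).weaken le_rfl (Set.subset_univ _)) hT⟩

theorem run_rlpnOn {n s N Niter : ℕ} (δ : ℝ) (it : Fin Niter → Pos n s × (Fin N → Sample s))
    (M : Mem s) : ((rlpnOn δ it).run M).1 = decoderVal δ (List.ofFn it) := by
  rw [← run_decoder_load δ _ M, List.map_ofFn]
  rfl

theorem rlpn_does {n m s N w Teq Niter : ℕ} (δ : ℝ) (e : Fin n → ZMod 2)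
    {H : Matrix (Fin m) (Fin n) (ZMod 2)} {c : Fin n → ZMod 2} (hc : c ∈ code H)
    {W : Finset (Cell s)} {P : Fin Niter → Pos n s} {create : Fin Niter → Prog s Unit} {M : Mem s}
    (hcr : ∀ j, IsCreate (c + e) H N w Teq W (P j) (create j)) (hin : InputLoaded (c + e) H M) :
    ∃ h : Fin Niter → Fin N → Fin n → ZMod 2, (∀ j, AreChecks (code H) w (P j) (h j)) ∧
      Does (rlpn N δ P create) M (Niter * (sourceTime n s N + Teq + (solveTime s N + 1)))
        (W ∪ inputCells n s ∪ sampleCells s N ∪ wordCells s) fun r _ =>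
          r = decoderVal δ (List.ofFn fun j => (P j, lpnSamples (onP (P j) e)
            (fun i => onP (P j) (h j i)) fun i => dotN (P j) e (h j i))) := by
  induction Niter generalizing M with
  | zero =>
    refine ⟨fun j => j.elim0, fun j => j.elim0, Does.weaken (T := 0) ?_ (Nat.zero_le _) subset_rfl⟩
    exact Does.ret rfl
  | succ Niter ih =>
    have hsource := source_does hin (hcr 0)
    obtain ⟨hin₁, h₀, hh₀, hsmp⟩ := hsource.post
    rw [samples_eq_lpnSamples hc e hh₀] at hsmp
    have hin₂ : InputLoaded (c + e) H
        ((solve s N δ).run ((source N (P 0) (create 0)).run M).2).2 :=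
      hin₁.of_eqOn (solve_does δ hsmp).frame.post.2 (by simp [sampleCells, wordCells])
        (by simp [sampleCells, wordCells])
    obtain ⟨h, hh, hrest⟩ := ih (fun j => hcr j.succ) hin₂
    refine ⟨Fin.cons h₀ h, Fin.cases hh₀ hh, ?_⟩
    unfold rlpn
    rw [List.ofFn_succ, List.ofFn_succ]
    exact (decoder_cons_does (Set.union_subset_union_left _ Set.subset_union_right)
      (.weaken ⟨hsmp, hsource.time_le, hsource.cells_subset⟩ le_rfl Set.subset_union_left)
      hrest).weaken (by rw [Nat.succ_mul]; omega) subset_rfl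

/-! ### Space and time -/

section Complexity

variable {n m s k N w Niter Seq Teq : ℕ} {δ : ℝ} {W : Finset (Cell s)} {M : Mem s}

theorem card_checks_le {y : Fin n → ZMod 2} {H : Matrix (Fin m) (Fin n) (ZMod 2)} {P : Pos n s}
    {create : Prog s Unit} (hin : InputLoaded y H M) (hcr : IsCreate y H N w Teq W P create) :
    N * n ≤ Teq ∧ N * n ≤ W.card := by
  classical
  obtain ⟨hpos, hframe⟩ := (writePos_does P M).frame.post
  have hin' := hin.of_eqOn hframe (by simp) (by simp)
  have hcreate := hcr.does hin' hpos
  set M' := ((writePos P).run M).2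
  let chk : Fin N × Fin n → Cell s := fun q => .chk q.1 q.2
  have chk_injective : Function.Injective chk := by
    rintro ⟨i, j⟩ ⟨i', j'⟩ h
    simp only [chk, Cell.chk.injEq] at h
    exact Prod.ext (Fin.ext h.1) (Fin.ext h.2)
  have chk_subset : Finset.univ.image chk ⊆ create.cells M' :=
    Finset.image_subset_iff.2 fun q _ => hcr.chk_mem_cells hin' hpos q.1 q.2
  have hle : N * n ≤ (create.cells M').card := by
    simpa [Finset.card_image_of_injective _ chk_injective] using Finset.card_le_card chk_subset
  exact ⟨hle.trans ((card_cells_le_time _ _).trans hcreate.time_le),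
    hle.trans (Finset.card_le_card (Finset.coe_subset.1 hcreate.cells_subset))⟩

theorem ncard_range_le {α β : Type*} [Fintype α] (f : α → β) :
    (Set.range f).ncard ≤ Fintype.card α := by
  rw [← Set.image_univ, ← Nat.card_eq_fintype_card, ← Set.ncard_univ]
  exact Set.ncard_image_le Set.finite_univ

theorem ncard_inputCells_le (n s : ℕ) : (inputCells n s).ncard ≤ s + n := by
  refine (Set.ncard_union_le _ _).trans ?_
  simpa only [Fintype.card_fin] using add_le_add
    (ncard_range_le fun l : Fin s => (.pos l : Cell s))
    (ncard_range_le fun j : Fin n => (.inp j : Cell s))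

theorem ncard_sampleCells_le (s N : ℕ) : (sampleCells s N).ncard ≤ N * s + N := by
  refine (Set.ncard_union_le _ _).trans ?_
  simpa only [Fintype.card_prod, Fintype.card_fin] using add_le_add
    (ncard_range_le fun q : Fin N × Fin s => (.smpA q.1 q.2 : Cell s))
    (ncard_range_le fun i : Fin N => (.smpB i : Cell s))

theorem ncard_wordCells_le (s : ℕ) : (wordCells s).ncard ≤ 3 * 2 ^ s := by
  have hword (f : Word s → Cell s) : (Set.range f).ncard ≤ 2 ^ s := by
    simpa [ZMod.card] using ncard_range_le f
  refine (Set.ncard_union_le _ _).trans ((add_le_add ((Set.ncard_union_le _ _).trans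
    (add_le_add (hword _) (hword _))) (hword _)).trans_eq (by ring))

theorem card_le_of_subset_cells {F : Finset (Cell s)}
    (hF : ↑F ⊆ ↑W ∪ inputCells n s ∪ sampleCells s N ∪ wordCells s) :
    F.card ≤ W.card + (s + n) + (N * s + N) + 3 * 2 ^ s := by
  have hfinite : (↑W ∪ inputCells n s ∪ sampleCells s N ∪ wordCells s).Finite := by
    simp only [inputCells, sampleCells, wordCells, Set.finite_union, Set.finite_range,
      Finset.finite_toSet, and_self]
  calc F.card = (F : Set (Cell s)).ncard := (Set.ncard_coe_finset F).symm
    _ ≤ _ := Set.ncard_le_ncard hF hfinite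
    _ ≤ (W : Set (Cell s)).ncard + (s + n) + (N * s + N) + 3 * 2 ^ s :=
      (Set.ncard_union_le _ _).trans (add_le_add ((Set.ncard_union_le _ _).trans (add_le_add
        ((Set.ncard_union_le _ _).trans (add_le_add le_rfl (ncard_inputCells_le n s)))
        (ncard_sampleCells_le s N))) (ncard_wordCells_le s))
    _ = _ := by rw [Set.ncard_coe_finset]

variable {e : Fin n → ZMod 2} {H : Matrix (Fin (n - k)) (Fin n) (ZMod 2)} {c : Fin n → ZMod 2}
  {P : Fin Niter → Pos n s} {create : Fin Niter → Prog s Unit}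

theorem le_of_isExecution (hN : 1 ≤ N) (hNiter : 0 < Niter)
    (hex : IsExecution k N w Seq Teq e H c P create W M) : n ≤ Teq :=
  (Nat.le_mul_of_pos_left n hN).trans (card_checks_le hex.2.2.2 (hex.2.2.1 ⟨0, hNiter⟩)).1

theorem time_le (hs : s ≤ n) (hn : 1 ≤ n) (hN : 1 ≤ N)
    (hex : IsExecution k N w Seq Teq e H c P create W M) :
    (rlpn N δ P create).time M ≤ 40 * (Niter * (Teq + (s + 1) * 2 ^ s)) := by
  obtain ⟨hc, -, hcr, hin⟩ := hex
  obtain ⟨h, -, hd⟩ := rlpn_does δ e hc hcr hin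
  rw [mul_left_comm]
  refine hd.time_le.trans ?_
  rcases Nat.eq_zero_or_pos Niter with rfl | hNiter
  · simp
  refine Nat.mul_le_mul_left _ ?_
  have hNn : N * n ≤ Teq := (card_checks_le hin (hcr ⟨0, hNiter⟩)).1
  have hn' : n ≤ N * n := Nat.le_mul_of_pos_left n hN
  have hN' : N ≤ N * n := Nat.le_mul_of_pos_right N hn
  have hNs : N * s ≤ N * n := Nat.mul_le_mul_left N hs
  have hpow : 1 ≤ 2 ^ s := Nat.one_le_two_pow
  have hspow : s ≤ s * 2 ^ s := Nat.le_mul_of_pos_right s hpow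
  unfold sourceTime solveTime
  linarith

theorem card_cells_le (hs : s ≤ n) (hn : 1 ≤ n) (hN : 1 ≤ N)
    (hex : IsExecution k N w Seq Teq e H c P create W M) :
    ((rlpn N δ P create).cells M).card ≤ 5 * (Seq + 2 ^ s) := by
  rcases Nat.eq_zero_or_pos Niter with rfl | hNiter
  · have := (card_cells_le_time _ _).trans (time_le (δ := δ) hs hn hN hex)
    omega
  obtain ⟨hc, hW, hcr, hin⟩ := hex
  obtain ⟨h, -, hd⟩ := rlpn_does δ e hc hcr hin
  have hcard := card_le_of_subset_cells hd.cells_subset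
  have hNn : N * n ≤ W.card := (card_checks_le hin (hcr ⟨0, hNiter⟩)).2
  have hn' : n ≤ N * n := Nat.le_mul_of_pos_left n hN
  have hN' : N ≤ N * n := Nat.le_mul_of_pos_right N hn
  have hNs : N * s ≤ N * n := Nat.mul_le_mul_left N hs
  omega

end Complexity

theorem one_le_log {g : ℝ} (hg : 3 ≤ g) : 1 ≤ Real.log g := by
  rw [Real.le_log_iff_exp_le (by linarith)]
  linarith [Real.exp_one_lt_d9]

theorem add_one_le_three_mul_log {s : ℕ} {g : ℝ} (h3 : 3 ≤ g) (hg : (2 : ℝ) ^ s ≤ g) :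
    (s : ℝ) + 1 ≤ 3 * Real.log g := by
  have hlog : s * Real.log 2 ≤ Real.log g := by
    rw [← Real.log_pow]
    exact Real.log_le_log (by positivity) hg
  have half_le : (s : ℝ) * (1 / 2) ≤ s * Real.log 2 :=
    mul_le_mul_of_nonneg_left (by linarith [Real.log_two_gt_d9]) (Nat.cast_nonneg s)
  linarith [one_le_log h3]

theorem add_mul_two_pow_le {s : ℕ} {T g : ℝ} (hT : 3 ≤ T) (hg : T + 2 ^ s ≤ g) :
    T + (s + 1) * 2 ^ s ≤ 3 * Real.log g * (T + 2 ^ s) := by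
  have hpow : (0 : ℝ) < 2 ^ s := by positivity
  calc T + (s + 1) * 2 ^ s ≤ (s + 1) * (T + 2 ^ s) := by
        nlinarith [mul_nonneg (Nat.cast_nonneg (α := ℝ) s) (by linarith : 0 ≤ T)]
    _ ≤ 3 * Real.log g * (T + 2 ^ s) := by
      gcongr
      exact add_one_le_three_mul_log (by linarith) (by linarith)

theorem time_isSoftO {k s w N Niter Seq Teq : ℕ → ℕ} {p : ℕ → ℝ} (hs : ∀ n, s n ≤ n)
    (e : ∀ n, Fin n → ZMod 2) (hp1 : ∀ n, p n ≤ 1)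
    (hN : ∀ᶠ n in Filter.atTop, 1 ≤ N n) (hp : ∀ᶠ n in Filter.atTop, 0 < p n) {a : ℕ}
    (hO : (fun n => (Niter n : ℝ)) =O[Filter.atTop] fun n =>
      1 / p n * Real.log ((Teq n + 2 ^ s n) / p n) ^ a) :
    ∃ (K : ℝ) (a : ℕ), ∀ᶠ n in Filter.atTop,
      ∀ (δ : ℝ) (H : Matrix (Fin (n - k n)) (Fin n) (ZMod 2))
      (c : Fin n → ZMod 2) (P : Fin (Niter n) → Pos n (s n))
      (create : Fin (Niter n) → Prog (s n) Unit) (W : Finset (Cell (s n))) (M : Mem (s n)),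
      IsExecution (k n) (N n) (w n) (Seq n) (Teq n) (e n) H c P create W M →
      ((rlpn (N n) δ P create).time M : ℝ) ≤
        K * ((Teq n + 2 ^ s n) / p n * Real.log ((Teq n + 2 ^ s n) / p n) ^ a) := by
  obtain ⟨C, hC0, hC⟩ := hO.exists_nonneg
  refine ⟨120 * C, a + 1, ?_⟩
  filter_upwards [hN, hp, hC.bound, Filter.eventually_ge_atTop 3] with n hN hp hC hn
  intro δ H c P create W M hex
  set G : ℝ := Teq n + 2 ^ s n
  set L : ℝ := Real.log (G / p n) with hL
  have hGp : G ≤ G / p n := le_div_self (by positivity) hp (hp1 n)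
  have one_le_G : 1 ≤ G := by
    linarith [one_le_pow₀ (M₀ := ℝ) one_le_two (n := s n), (Teq n).cast_nonneg (α := ℝ)]
  have hL0 : 0 ≤ L := Real.log_nonneg (one_le_G.trans hGp)
  have htime : ((rlpn (N n) δ P create).time M : ℝ) ≤
      40 * (Niter n * (Teq n + (s n + 1) * 2 ^ s n)) := by
    exact_mod_cast time_le (hs n) (by omega) hN hex
  refine htime.trans ?_
  rcases Nat.eq_zero_or_pos (Niter n) with hNiter | hNiter
  · rw [hNiter, Nat.cast_zero, zero_mul, mul_zero]
    positivity
  have hTeq : (3 : ℝ) ≤ Teq n := by exact_mod_cast hn.trans (le_of_isExecution hN hNiter hex)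
  rw [Real.norm_of_nonneg (Nat.cast_nonneg _), Real.norm_of_nonneg (by positivity)] at hC
  calc 40 * (Niter n * (Teq n + (s n + 1) * 2 ^ s n))
      ≤ 40 * ((C * (1 / p n * L ^ a)) * (3 * L * G)) := by
        gcongr
        exact add_mul_two_pow_le hTeq hGp
    _ = 120 * C * (G / p n * L ^ (a + 1)) := by ring

/-! ### The number of errors outside a random set of positions -/

section SubsetSums

variable {α : Type*} [DecidableEq α] {E X : Finset α}

theorem sum_powerset_inter_sdiff {M : Type*} [AddCommMonoid M] (hEX : E ⊆ X)
    (F : Finset α → Finset α → M) :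
    ∑ S ∈ X.powerset, F (S ∩ E) (S \ E) =
      ∑ A ∈ E.powerset, ∑ B ∈ (X \ E).powerset, F A B := by
  rw [← Finset.sum_product']
  refine Finset.sum_nbij' (fun S => (S ∩ E, S \ E)) (fun q => q.1 ∪ q.2) ?_ ?_ ?_ ?_ fun _ _ => rfl
  · intro S hS
    exact Finset.mem_product.2 ⟨Finset.mem_powerset.2 Finset.inter_subset_right,
      Finset.mem_powerset.2 (Finset.sdiff_subset_sdiff (Finset.mem_powerset.1 hS) subset_rfl)⟩
  · rintro ⟨A, B⟩ hq
    simp only [Finset.mem_product, Finset.mem_powerset] at hq ⊢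
    exact Finset.union_subset (hq.1.trans hEX) (hq.2.trans Finset.sdiff_subset)
  · intro S _
    exact (Finset.union_comm _ _).trans (Finset.sdiff_union_inter S E)
  · rintro ⟨A, B⟩ hq
    simp only [Finset.mem_product, Finset.mem_powerset] at hq
    have hBE : Disjoint B E := Finset.disjoint_of_subset_left hq.2 Finset.sdiff_disjoint
    simp only [Finset.union_inter_distrib_right, Finset.inter_eq_left.2 hq.1,
      Finset.disjoint_iff_inter_eq_empty.1 hBE, Finset.union_empty, Finset.union_sdiff_distrib,
      Finset.sdiff_eq_empty_iff_subset.2 hq.1, Finset.empty_union,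
      Finset.sdiff_eq_self_of_disjoint hBE]

theorem card_filter_card_inter_eq (hEX : E ⊆ X) {s a : ℕ} (has : a ≤ s) :
    {P ∈ X.powersetCard s | (P ∩ E).card = a}.card =
      E.card.choose a * (X \ E).card.choose (s - a) := by
  rw [Finset.powersetCard_eq_filter, Finset.filter_filter, Finset.card_filter]
  calc _ = ∑ S ∈ X.powerset, (if (S ∩ E).card = a then 1 else 0) *
        (if (S \ E).card = s - a then 1 else 0) := by
        refine Finset.sum_congr rfl fun S _ => ?_
        have := Finset.card_inter_add_card_sdiff S E
        rw [ite_zero_mul_ite_zero, one_mul]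
        exact if_congr (by omega) rfl rfl
    _ = ∑ A ∈ E.powerset, ∑ B ∈ (X \ E).powerset, (if A.card = a then 1 else 0) *
        (if B.card = s - a then 1 else 0) :=
        sum_powerset_inter_sdiff hEX fun A B =>
          (if A.card = a then 1 else 0) * (if B.card = s - a then 1 else 0)
    _ = _ := by
        rw [← Finset.sum_mul_sum, ← Finset.card_filter, ← Finset.card_filter,
          ← Finset.powersetCard_eq_filter, ← Finset.powersetCard_eq_filter,
          Finset.card_powersetCard, Finset.card_powersetCard]

end SubsetSums

theorem choose_mul_choose_symm (a b u r : ℕ) :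
    ((a + u).choose a * (b + r).choose b : ℝ) * ((a + b) + (u + r)).choose (a + u) =
      ((a + b).choose a * (u + r).choose u : ℝ) * ((a + b) + (u + r)).choose (a + b) := by
  have factorial_ne_zero (i : ℕ) : (i.factorial : ℝ) ≠ 0 := Nat.cast_ne_zero.2 i.factorial_ne_zero
  have hchoose : ((a + b + (u + r)).choose (a + u) : ℝ) =
      (a + b + (u + r)).factorial / ((a + u).factorial * (b + r).factorial) := by
    rw [show a + b + (u + r) = a + u + (b + r) by ring, Nat.cast_add_choose]
  rw [hchoose]
  simp only [Nat.cast_add_choose]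
  have := factorial_ne_zero (a + u)
  have := factorial_ne_zero (b + r)
  have := factorial_ne_zero (a + b)
  have := factorial_ne_zero (u + r)
  field_simp

section ErrorCount

variable {n s t u : ℕ} {e : Fin n → ZMod 2}

theorem weightN_eq_iff (hut : u ≤ t) (he : hammingNorm e = t) (P : Pos n s) :
    weightN P e = u ↔ (P.1 ∩ Finset.univ.filter fun j => e j ≠ 0).card = t - u := by
  have hcompl : (P.1ᶜ.filter fun j => e j ≠ 0) = (Finset.univ.filter fun j => e j ≠ 0) \ P.1 := by
    ext j
    simp [and_comm]
  have hsplit := Finset.card_sdiff_add_card_inter (Finset.univ.filter fun j => e j ≠ 0) P.1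
  have htotal : (Finset.univ.filter fun j => e j ≠ 0).card = t := he
  rw [weightN, hcompl, Finset.inter_comm]
  omega

theorem card_pos (n s : ℕ) : Fintype.card (Pos n s) = n.choose s := by
  rw [Fintype.card_finset_len, Fintype.card_fin]

theorem nonempty_pos (hs : s ≤ n) : Nonempty (Pos n s) :=
  Fintype.card_pos_iff.1 (by rw [card_pos]; exact Nat.choose_pos hs)

theorem card_weightN_eq_card_filter (hut : u ≤ t) (he : hammingNorm e = t) :
    {P : Pos n s | weightN P e = u}.toFinset.card =
      {P ∈ (Finset.univ : Finset (Fin n)).powersetCard s |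
        (P ∩ Finset.univ.filter fun j => e j ≠ 0).card = t - u}.card := by
  rw [← Finset.card_map (Function.Embedding.subtype _)]
  congr 1
  ext P
  simp [weightN_eq_iff hut he, and_comm]

theorem card_weightN_eq (hs : s ≤ n) (hut : u ≤ t) (hun : u ≤ n - s) (he : hammingNorm e = t) :
    ({P : Pos n s | weightN P e = u}.toFinset.card : ℝ) = pSucc n s t u * n.choose s := by
  have herr : (Finset.univ.filter fun j => e j ≠ 0).card = t := he
  have htn : t ≤ n := herr ▸ (Finset.card_le_univ _).trans (Fintype.card_fin n).le
  rw [card_weightN_eq_card_filter hut he]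
  rcases lt_or_ge s (t - u) with hlt | hle
  · rw [pSucc, Nat.choose_eq_zero_of_lt hlt]
    simp only [Nat.cast_zero, zero_mul, zero_div, Nat.cast_eq_zero, Finset.card_eq_zero]
    refine Finset.filter_eq_empty_iff.2 fun P hP hinter => hlt.not_ge ?_
    rw [← hinter, ← (Finset.mem_powersetCard.1 hP).2]
    exact Finset.card_le_card Finset.inter_subset_left
  rw [card_filter_card_inter_eq (Finset.subset_univ _) hle, Finset.card_univ_sdiff, herr,
    Fintype.card_fin, pSucc]
  have hchoose : (n.choose t : ℝ) ≠ 0 := Nat.cast_ne_zero.2 (Nat.choose_pos htn).ne'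
  obtain ⟨a, rfl⟩ : ∃ a, t = a + u := ⟨t - u, by omega⟩
  rw [Nat.add_sub_cancel] at hle ⊢
  obtain ⟨b, rfl⟩ : ∃ b, s = a + b := ⟨s - a, by omega⟩
  obtain ⟨r, rfl⟩ : ∃ r, n = a + b + (u + r) := ⟨n - (a + b + u), by omega⟩
  rw [div_mul_eq_mul_div, eq_div_iff hchoose, show a + b + (u + r) - (a + u) = b + r by omega,
    show a + b - a = b by omega, show a + b + (u + r) - (a + b) = u + r by omega, Nat.cast_mul]
  exact choose_mul_choose_symm a b u r

theorem uniformPos_weightN_eq (hs : s ≤ n) (hut : u ≤ t) (hun : u ≤ n - s)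
    (he : hammingNorm e = t) :
    (uniformPos hs).toOuterMeasure {P | weightN P e = u} = ENNReal.ofReal (pSucc n s t u) := by
  classical
  have hpos : (0 : ℝ) < n.choose s := Nat.cast_pos.2 (Nat.choose_pos hs)
  have := nonempty_pos hs
  rw [uniformPos, PMF.toOuterMeasure_uniformOfFintype_apply, card_pos,
    ← (div_eq_iff hpos.ne').2 (card_weightN_eq hs hut hun he), ENNReal.ofReal_div_of_pos hpos,
    ENNReal.ofReal_natCast, ENNReal.ofReal_natCast, Set.toFinset_card]

theorem pSucc_le_one (hs : s ≤ n) (hut : u ≤ t) (hun : u ≤ n - s) (he : hammingNorm e = t) :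
    pSucc n s t u ≤ 1 := by
  refine le_of_mul_le_mul_right ?_ (Nat.cast_pos.2 (Nat.choose_pos hs) : (0 : ℝ) < n.choose s)
  rw [← card_weightN_eq hs hut hun he, one_mul, ← card_pos]
  exact_mod_cast Finset.card_le_univ _

end ErrorCount

/-! ### Finite probability -/

/-- The expectation of `f` under a probability law `p` on a finite type. -/
def expect {α : Type} [Fintype α] (p : PMF α) (f : α → ℝ) : ℝ := ∑ x, (p x).toReal * f x

open Classical in
/-- The probability of the event `A` under a law `p` on a finite type, as a real number. -/
def prob {α : Type} [Fintype α] (p : PMF α) (A : α → Prop) : ℝ :=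
  expect p fun x => if A x then 1 else 0

section Expectation

variable {α β : Type} [Fintype α] [Fintype β] (p : PMF α)

theorem sum_toReal_pmf : ∑ x, (p x).toReal = 1 := by
  rw [← ENNReal.toReal_sum fun x _ => p.apply_ne_top x, ← tsum_fintype (L := .unconditional _),
    p.tsum_coe, ENNReal.toReal_one]

theorem expect_const (c : ℝ) : expect p (fun _ => c) = c := by
  rw [expect, ← Finset.sum_mul, sum_toReal_pmf, one_mul]

variable {p} in
theorem expect_mono {f g : α → ℝ} (h : ∀ x, f x ≤ g x) : expect p f ≤ expect p g :=
  Finset.sum_le_sum fun x _ => mul_le_mul_of_nonneg_left (h x) ENNReal.toReal_nonneg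

variable {p} in
theorem expect_nonneg {f : α → ℝ} (h : ∀ x, 0 ≤ f x) : 0 ≤ expect p f :=
  (expect_const p 0).ge.trans (expect_mono h)

theorem expect_add (f g : α → ℝ) :
    expect p (fun x => f x + g x) = expect p f + expect p g := by
  simp only [expect, mul_add, Finset.sum_add_distrib]

theorem expect_sub (f g : α → ℝ) :
    expect p (fun x => f x - g x) = expect p f - expect p g := by
  simp only [expect, mul_sub, Finset.sum_sub_distrib]

theorem expect_const_mul (c : ℝ) (f : α → ℝ) :
    expect p (fun x => c * f x) = c * expect p f := by
  simp only [expect, Finset.mul_sum, mul_left_comm]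

theorem expect_mul_const (c : ℝ) (f : α → ℝ) :
    expect p (fun x => f x * c) = expect p f * c := by
  simp only [mul_comm _ c, expect_const_mul]

theorem expect_sum {ι : Type*} (S : Finset ι) (f : ι → α → ℝ) :
    expect p (fun x => ∑ i ∈ S, f i x) = ∑ i ∈ S, expect p (f i) := by
  simp only [expect, Finset.mul_sum]
  exact Finset.sum_comm

theorem expect_sum_sub_sq_le {ι : Type*} (S : Finset ι) (X : ι → α → ℝ) {μ ν : ℝ}
    (mean : ∀ i ∈ S, expect p (X i) = μ)
    (second_moment : ∀ i ∈ S, expect p (fun a => X i a ^ 2) = ν)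
    (uncorrelated : ∀ i ∈ S, ∀ j ∈ S, i ≠ j → expect p (fun a => X i a * X j a) = μ ^ 2) :
    expect p (fun a => (∑ i ∈ S, X i a - S.card * μ) ^ 2) ≤ S.card * ν := by
  have expand (a : α) : (∑ i ∈ S, X i a - S.card * μ) ^ 2 =
      ∑ i ∈ S, ∑ j ∈ S, (X i a - μ) * (X j a - μ) := by
    rw [← Finset.sum_mul_sum, ← sq, Finset.sum_sub_distrib, Finset.sum_const, nsmul_eq_mul]
  have expect_term {i j : ι} (hi : i ∈ S) (hj : j ∈ S) :
      expect p (fun a => (X i a - μ) * (X j a - μ)) =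
        expect p (fun a => X i a * X j a) - μ ^ 2 := by
    simp only [mul_sub, sub_mul, expect_sub, expect_mul_const, expect_const_mul, expect_const,
      mean i hi, mean j hj]
    ring
  simp only [expand, expect_sum]
  rw [← nsmul_eq_mul S.card ν]
  refine Finset.sum_le_card_nsmul _ _ _ fun i hi => ?_
  rw [Finset.sum_eq_single_of_mem i hi fun j hj hji => by
    rw [expect_term hi hj, uncorrelated i hi j hj hji.symm, sub_self], expect_term hi hi]
  simp only [← sq, second_moment i hi]
  exact sub_le_self _ (sq_nonneg μ)

theorem expect_pure (a : α) (f : α → ℝ) : expect (PMF.pure a) f = f a := by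
  classical
  simp [expect, PMF.pure_apply, apply_ite ENNReal.toReal]

theorem expect_bind (q : α → PMF β) (f : β → ℝ) :
    expect (p.bind q) f = expect p fun a => expect (q a) f := by
  have toReal_bind (b : β) :
      (p.bind q b).toReal = ∑ a, (p a).toReal * (q a b).toReal := by
    rw [PMF.bind_apply, tsum_fintype, ENNReal.toReal_sum fun a _ =>
      ENNReal.mul_ne_top (p.apply_ne_top a) ((q a).apply_ne_top b)]
    simp only [ENNReal.toReal_mul]
  simp only [expect, toReal_bind, Finset.sum_mul, Finset.mul_sum, mul_assoc]
  exact Finset.sum_comm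

theorem expect_map (g : α → β) (f : β → ℝ) :
    expect (p.map g) f = expect p fun a => f (g a) := by
  simp only [PMF.map, expect_bind, Function.comp_apply, expect_pure]

theorem expect_uniform [Nonempty α] (f : α → ℝ) :
    expect (PMF.uniformOfFintype α) f = (∑ x, f x) / Fintype.card α := by
  simp only [expect, PMF.uniformOfFintype_apply, ENNReal.toReal_inv, ENNReal.toReal_natCast,
    ← Finset.mul_sum, div_eq_inv_mul]

theorem expect_comm (q : PMF β) (f : α → β → ℝ) :
    expect p (fun a => expect q (f a)) = expect q fun b => expect p fun a => f a b := by
  simp only [expect, Finset.mul_sum, mul_left_comm]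
  exact Finset.sum_comm

theorem expect_iid_succ (m : ℕ) (f : (Fin (m + 1) → α) → ℝ) :
    expect (iid p (m + 1)) f = expect p fun a => expect (iid p m) fun v => f (Fin.cons a v) := by
  simp only [iid, expect_bind, expect_map]

theorem expect_iid_prod (g : α → ℝ) (m : ℕ) :
    expect (iid p m) (fun v => ∏ i, g (v i)) = expect p g ^ m := by
  induction m with
  | zero => simp [expect_const]
  | succ m ih =>
    simp only [expect_iid_succ, Fin.prod_univ_succ, Fin.cons_zero, Fin.cons_succ,
      expect_const_mul, ih, expect_mul_const, pow_succ']

end Expectation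

section Probability

variable {α β : Type} [Fintype α] {p : PMF α}

theorem prob_mono {A B : α → Prop} (h : ∀ x, A x → B x) : prob p A ≤ prob p B :=
  expect_mono fun x => by
    by_cases hA : A x
    · simp [hA, h x hA]
    · rw [if_neg hA]
      split_ifs <;> norm_num

theorem prob_nonneg (A : α → Prop) : 0 ≤ prob p A :=
  expect_nonneg fun x => by split_ifs <;> norm_num

theorem prob_not (A : α → Prop) : prob p (fun x => ¬ A x) = 1 - prob p A := by
  rw [prob, prob, ← expect_const p 1, ← expect_sub, expect_const]
  congr 1 with x
  split_ifs <;> norm_num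

theorem prob_le_one (A : α → Prop) : prob p A ≤ 1 :=
  sub_nonneg.1 ((prob_nonneg _).trans_eq (prob_not A))

theorem prob_or_le (A B : α → Prop) : prob p (fun x => A x ∨ B x) ≤ prob p A + prob p B := by
  rw [prob, prob, prob, ← expect_add]
  refine expect_mono fun x => ?_
  by_cases hA : A x <;> by_cases hB : B x <;> simp [hA, hB]

theorem prob_exists_le {ι : Type*} (S : Finset ι) (A : ι → α → Prop) :
    prob p (fun x => ∃ i ∈ S, A i x) ≤ ∑ i ∈ S, prob p (A i) := by
  classical
  simp only [prob, ← expect_sum]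
  refine expect_mono fun x => ?_
  have hterm (i : ι) : (0 : ℝ) ≤ if A i x then 1 else 0 := by split_ifs <;> norm_num
  split_ifs with h
  · obtain ⟨i, hi, hA⟩ := h
    exact (if_pos hA).ge.trans (Finset.single_le_sum (fun j _ => hterm j) hi)
  · exact Finset.sum_nonneg fun j _ => hterm j

theorem markov_inequality {X : α → ℝ} (hX : ∀ x, 0 ≤ X x) {a : ℝ} (ha : 0 < a) :
    prob p (fun x => a ≤ X x) ≤ expect p X / a := by
  rw [div_eq_mul_inv, ← expect_mul_const]
  refine expect_mono fun x => ?_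
  rw [← div_eq_mul_inv]
  split_ifs with h
  · exact (one_le_div ha).2 h
  · exact div_nonneg (hX x) ha.le

theorem chebyshev_inequality (X : α → ℝ) {a : ℝ} (ha : 0 < a) :
    prob p (fun x => a ≤ |X x|) ≤ expect p (fun x => X x ^ 2) / a ^ 2 :=
  (prob_mono fun x (h : a ≤ |X x|) => by
    simpa only [sq_abs] using pow_le_pow_left₀ ha.le h 2).trans
    (markov_inequality (fun x => sq_nonneg (X x)) (by positivity))

theorem prob_bind [Fintype β] (q : α → PMF β) (A : β → Prop) :
    prob (p.bind q) A = expect p fun a => prob (q a) A :=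
  expect_bind p q _

theorem prob_map [Fintype β] (g : α → β) (A : β → Prop) :
    prob (p.map g) A = prob p fun a => A (g a) :=
  expect_map p g _

theorem prob_bind_le_add [Fintype β] {q : α → PMF β} {A : β → Prop} {B : α → Prop} {c : ℝ}
    (hc : 0 ≤ c) (h : ∀ a, ¬ B a → prob (q a) A ≤ c) :
    prob (p.bind q) A ≤ prob p B + c := by
  rw [prob_bind, prob, ← expect_const p c, ← expect_add]
  refine expect_mono fun a => ?_
  split_ifs with hB
  · exact (prob_le_one _).trans (le_add_of_nonneg_right hc)
  · exact (h a hB).trans_eq (zero_add c).symm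

theorem prob_iid_succ (m : ℕ) (A : (Fin (m + 1) → α) → Prop) :
    prob (iid p (m + 1)) A = expect p fun a => prob (iid p m) fun v => A (Fin.cons a v) :=
  expect_iid_succ p m _

theorem toOuterMeasure_eq_ofReal_prob (S : Set α) :
    p.toOuterMeasure S = ENNReal.ofReal (prob p fun x => x ∈ S) := by
  classical
  rw [PMF.toOuterMeasure_apply_fintype, prob, expect,
    ENNReal.ofReal_sum_of_nonneg fun x _ => by split_ifs <;> simp]
  refine Finset.sum_congr rfl fun x _ => ?_
  by_cases h : x ∈ S <;> simp [h, ENNReal.ofReal_toReal (p.apply_ne_top x)]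

/-! ### Independent trials -/

theorem chernoff_bound (Y : α → ℝ) (m : ℕ) (θ r : ℝ) :
    prob (iid p m) (fun v => θ ≤ r * ∑ i, Y (v i)) ≤
      Real.exp (-θ) * expect p (fun a => Real.exp (r * Y a)) ^ m := by
  have markov := markov_inequality (p := iid p m) (X := fun v => Real.exp (r * ∑ i, Y (v i)))
    (fun v => (Real.exp_pos _).le) (Real.exp_pos θ)
  simp only [Real.exp_le_exp] at markov
  refine markov.trans_eq ?_
  simp only [Finset.mul_sum, Real.exp_sum, Real.exp_neg, div_eq_inv_mul]
  rw [expect_iid_prod p fun a => Real.exp (r * Y a)]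

-- A trial with the outcome `none` is repeated; the outcome that ends the trials is bad with
-- probability at most `b / g`.
theorem prob_not_good_findSome_le (f : α → Option β) (good : β → Prop) {g b : ℝ} (hg0 : 0 < g)
    (hg : g ≤ prob p fun a => ∃ y ∈ f a, good y)
    (hb : prob p (fun a => ∃ y ∈ f a, ¬ good y) ≤ b) (m : ℕ) :
    prob (iid p m) (fun v => ¬ ∃ y ∈ (List.ofFn v).findSome? f, good y) ≤
      (1 - g) ^ m + b / g := by
  classical
  have hb0 : 0 ≤ b := (prob_nonneg _).trans hb
  induction m with
  | zero =>
    rw [pow_zero]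
    exact (prob_le_one _).trans (le_add_of_nonneg_right (by positivity))
  | succ m ih =>
    set F := prob (iid p m) fun v => ¬ ∃ y ∈ (List.ofFn v).findSome? f, good y with hF
    have first_trial (a : α) :
        prob (iid p m) (fun v => ¬ ∃ y ∈ (List.ofFn (Fin.cons a v : Fin (m + 1) → α)).findSome? f,
          good y) ≤
        (if ∃ y ∈ f a, ¬ good y then (1 : ℝ) else 0) +
          (F - (if ∃ y ∈ f a, good y then (1 : ℝ) else 0) * F) := by
      cases hfa : f a with
      | none => simp [List.ofFn_succ, hfa, hF]
      | some y =>
        by_cases hy : good y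
        · simp [List.ofFn_succ, hfa, hy, prob, expect_const]
        · simpa [hfa, hy] using (prob_le_one _).trans (le_add_of_nonneg_right (prob_nonneg _))
    rw [prob_iid_succ]
    calc _ ≤ _ := expect_mono first_trial
      _ = prob p (fun a => ∃ y ∈ f a, ¬ good y) +
          (F - prob p (fun a => ∃ y ∈ f a, good y) * F) := by
        rw [expect_add, expect_sub, expect_const, expect_mul_const, prob, prob]
        congr!
      _ ≤ b + (F - g * F) := by
        gcongr
        exact prob_nonneg _
      _ = (1 - g) * F + b := by ring
      _ ≤ (1 - g) * ((1 - g) ^ m + b / g) + b := by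
        gcongr
        exact sub_nonneg.2 (hg.trans (prob_le_one _))
      _ = (1 - g) ^ (m + 1) + b / g := by
        field_simp
        ring

end Probability

/-! ### The Fourier transform of the log-likelihood function -/

section LogLikelihood

variable {s N : ℕ} {δ : ℝ}

theorem exp_mul_sgn (c : ℝ) (b : ZMod 2) :
    Real.exp (c * sgn b) = Real.cosh c + sgn b * Real.sinh c := by
  rcases zmod_two_eq_zero_or_one b with rfl | rfl
  · rw [sgn.map_zero_eq_one, mul_one, one_mul, Real.cosh_add_sinh]
  · rw [sgn_one, mul_neg_one, neg_one_mul, ← sub_eq_add_neg, Real.cosh_sub_sinh]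

/-- The agreement of the word `x` with the sample `(a, b)`: it is `1` if `b = ⟨x, a⟩` and `-1`
otherwise. -/
def agreement (x : Word s) (q : Sample s) : ℝ := sgn (dotProduct x q.1 + q.2)

theorem pFlip_mem_Ioo (hδ : |δ| < 1) (b : ZMod 2) : pFlip δ b ∈ Set.Ioo 0 1 := by
  obtain ⟨h1, h2⟩ := abs_lt.1 hδ
  rw [pFlip]
  split_ifs <;> constructor <;> linarith

theorem log_pFlip (hδ : |δ| < 1) (b : ZMod 2) :
    Real.log ((1 - pFlip δ b) / pFlip δ b) = sgn b * Real.log ((1 + δ) / (1 - δ)) := by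
  have h0 : (1 - (1 - δ) / 2) / ((1 - δ) / 2) = (1 + δ) / (1 - δ) := by
    have : 1 - δ ≠ 0 := by linarith [(abs_lt.1 hδ).2]
    field_simp
    ring
  rcases zmod_two_eq_zero_or_one b with rfl | rfl
  · rw [pFlip, if_pos rfl, h0, sgn.map_zero_eq_one, one_mul]
  · rw [pFlip, if_neg one_ne_zero, sub_sub_cancel, ← inv_div, h0, Real.log_inv, sgn_one,
      neg_one_mul]

theorem llr_eq_sum (hδ : |δ| < 1) (smp : Fin N → Sample s) (a : Word s) :
    llr δ smp a = ∑ i with (smp i).1 = a, sgn (smp i).2 * Real.log ((1 + δ) / (1 - δ)) := by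
  rw [llr_eq_log, pOne]
  set A := ∏ i with (smp i).1 = a, pFlip δ (smp i).2 with hA
  set B := ∏ i with (smp i).1 = a, (1 - pFlip δ (smp i).2) with hB
  have pFlip_pos i : 0 < pFlip δ (smp i).2 := (pFlip_mem_Ioo hδ _).1
  have one_sub_pFlip_pos i : 0 < 1 - pFlip δ (smp i).2 := sub_pos.2 (pFlip_mem_Ioo hδ _).2
  have hA0 : 0 < A := Finset.prod_pos fun i _ => pFlip_pos i
  have hB0 : 0 < B := Finset.prod_pos fun i _ => one_sub_pFlip_pos i
  have odds : (1 - A / (A + B)) / (A / (A + B)) = B / A := by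
    field_simp
    ring
  rw [odds, hA, hB, ← Finset.prod_div_distrib,
    Real.log_prod fun i _ => (div_pos (one_sub_pFlip_pos i) (pFlip_pos i)).ne']
  exact Finset.sum_congr rfl fun i _ => log_pFlip hδ _

theorem fourier_llr (hδ : |δ| < 1) (smp : Fin N → Sample s) (x : Word s) :
    fourier (llr δ smp) x = Real.log ((1 + δ) / (1 - δ)) * ∑ i, agreement x (smp i) := by
  simp only [fourier_eq, llr_eq_sum hδ, Finset.sum_filter, Finset.sum_mul, Finset.mul_sum]
  rw [Finset.sum_comm]
  refine Finset.sum_congr rfl fun i _ => ?_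
  simp only [ite_mul, zero_mul, Finset.sum_ite_eq, Finset.mem_univ, if_true, agreement,
    AddChar.map_add_eq_mul]
  ring

-- The logarithm in the threshold has the sign of `δ`, so it cancels when `δ` is put in its place.
theorem threshold_le_iff (hδ : |δ| < 1) (hδ0 : δ ≠ 0) (smp : Fin N → Sample s) (x : Word s) :
    threshold δ N ≤ fourier (llr δ smp) x ↔ δ ^ 2 * N / 2 ≤ δ * ∑ i, agreement x (smp i) := by
  rw [fourier_llr hδ, threshold, mul_comm _ (Real.log _),
    show δ ^ 2 * (N : ℝ) / 2 = δ * (δ * N / 2) by ring]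
  obtain ⟨h1, h2⟩ := abs_lt.1 hδ
  rcases lt_or_gt_of_ne hδ0 with h | h
  · have log_neg : Real.log ((1 + δ) / (1 - δ)) < 0 :=
      Real.log_neg (div_pos (by linarith) (by linarith))
        ((div_lt_one (by linarith)).2 (by linarith))
    rw [mul_le_mul_left_of_neg log_neg, mul_le_mul_left_of_neg h]
  · have log_pos : 0 < Real.log ((1 + δ) / (1 - δ)) :=
      Real.log_pos ((one_lt_div (by linarith)).2 (by linarith))
    rw [mul_le_mul_iff_right₀ log_pos, mul_le_mul_iff_right₀ h]

theorem threshold_le_of_mem_solveVal {smp : Fin N → Sample s} {x : Word s}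
    (h : x ∈ solveVal δ smp) : threshold δ N ≤ fourier (llr δ smp) x := by
  rcases iterSpec_solveVal δ smp with ⟨hnone, -⟩ | ⟨y, hy, -, hle⟩
  · simp [hnone] at h
  · rwa [Option.mem_unique h hy]

theorem mem_solveVal {smp : Fin N → Sample s} {x : Word s}
    (hx : threshold δ N ≤ fourier (llr δ smp) x)
    (h : ¬∃ y ≠ x, threshold δ N ≤ fourier (llr δ smp) y) : x ∈ solveVal δ smp := by
  rcases iterSpec_solveVal δ smp with ⟨-, hlt⟩ | ⟨y, hy, -, hle⟩
  · exact absurd hx (not_le.2 (hlt x))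
  · by_cases hyx : y = x
    · exact hyx ▸ hy
    · exact absurd ⟨y, hyx, hle⟩ h

end LogLikelihood

/-! ### Samples of the LPN oracle -/

theorem expect_bernoulliBias {ε : ℝ} (hε : |ε| ≤ 1) (f : ZMod 2 → ℝ) :
    expect (bernoulliBias ε hε) f = (1 + ε) / 2 * f 0 + (1 - ε) / 2 * f 1 := by
  obtain ⟨h1, h2⟩ := abs_le.1 hε
  simp only [expect, sum_zmod_two, bernoulliBias, PMF.ofFintype_apply, if_true,
    if_neg (one_ne_zero (α := ZMod 2))]
  rw [ENNReal.toReal_ofReal (by linarith), ENNReal.toReal_ofReal (by linarith)]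

theorem sum_sgn_dotProduct {ι : Type*} [Fintype ι] [DecidableEq ι] {x : ι → ZMod 2} (hx : x ≠ 0) :
    ∑ a, sgn (dotProduct x a) = 0 := by
  obtain ⟨l, hl⟩ := Function.ne_iff.1 hx
  let ψ : AddChar (ι → ZMod 2) ℝ :=
    sgn.compAddMonoidHom ⟨⟨fun a => dotProduct x a, dotProduct_zero x⟩, dotProduct_add x⟩
  refine AddChar.sum_eq_zero_of_ne_one (ψ := ψ) (AddChar.ne_one_iff.2 ⟨Pi.single l 1, ?_⟩)
  have hxl : x l = 1 := (zmod_two_eq_zero_or_one _).resolve_left hl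
  change sgn (dotProduct x (Pi.single l 1)) ≠ 1
  rw [dotProduct_single, hxl, mul_one, sgn_one]
  norm_num

section Oracle

variable {s : ℕ} (x y : Word s) {δ ε : ℝ} (hε : |ε| ≤ 1)

theorem expect_agreement :
    expect (lpnOracle x ε hε) (agreement y) = if y = x then ε else 0 := by
  have expect_noise (a : Word s) :
      expect ((bernoulliBias ε hε).map fun η => (a, dotProduct x a + η)) (agreement y) =
        ε * sgn (dotProduct (y + x) a) := by
    rw [expect_map, expect_bernoulliBias]
    simp only [agreement, ← add_assoc, AddChar.map_add_eq_mul, AddChar.map_zero_eq_one, sgn_one,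
      add_dotProduct]
    ring
  simp only [lpnOracle, expect_bind, expect_noise, expect_const_mul, expect_uniform]
  split_ifs with h
  · simp [h, CharTwo.add_self_eq_zero]
  · have hyx : y + x ≠ 0 := fun h0 => h (funext fun l => CharTwo.add_eq_zero.1 (congrFun h0 l))
    rw [sum_sgn_dotProduct hyx, zero_div, mul_zero]

theorem expect_exp_agreement (c : ℝ) :
    expect (lpnOracle x ε hε) (fun q => Real.exp (c * agreement y q)) =
      Real.cosh c + (if y = x then ε else 0) * Real.sinh c := by
  calc _ = expect (lpnOracle x ε hε) fun q => Real.cosh c + agreement y q * Real.sinh c := by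
        simp only [agreement, exp_mul_sgn]
    _ = _ := by
        rw [expect_add, expect_const, expect_mul_const]
        exact congrArg (_ + · * _) (expect_agreement x y hε)

variable {x y} in
theorem prob_accept_false_le (hy : y ≠ x) (hδ : |δ| < 1) (hδ0 : δ ≠ 0) (N : ℕ) :
    prob (iid (lpnOracle x ε hε) N) (fun smp => threshold δ N ≤ fourier (llr δ smp) y) ≤
      Real.exp (-(N * δ ^ 2 / 8)) := by
  calc _ ≤ prob (iid (lpnOracle x ε hε) N)
        fun smp => δ ^ 2 * N / 4 ≤ δ / 2 * ∑ i, agreement y (smp i) :=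
        prob_mono fun smp h => by linarith [(threshold_le_iff hδ hδ0 smp y).1 h]
    _ ≤ Real.exp (-(δ ^ 2 * N / 4)) * Real.cosh (δ / 2) ^ N := by
        refine (chernoff_bound (agreement y) N (δ ^ 2 * N / 4) (δ / 2)).trans_eq ?_
        rw [expect_exp_agreement, if_neg hy, zero_mul, add_zero]
    _ ≤ Real.exp (-(δ ^ 2 * N / 4)) * Real.exp ((δ / 2) ^ 2 / 2) ^ N := by
        gcongr
        exact Real.cosh_le_exp_half_sq _
    _ = Real.exp (-(N * δ ^ 2 / 8)) := by
        rw [← Real.exp_nat_mul, ← Real.exp_add]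
        congr 1
        ring

theorem prob_accept_wrong_le (hδ : |δ| < 1) (hδ0 : δ ≠ 0) (N : ℕ) :
    prob (iid (lpnOracle x ε hε) N)
      (fun smp => ∃ y ≠ x, threshold δ N ≤ fourier (llr δ smp) y) ≤
      2 ^ s * Real.exp (-(N * δ ^ 2 / 8)) := by
  calc _ = prob (iid (lpnOracle x ε hε) N) fun smp =>
        ∃ y ∈ Finset.univ.erase x, threshold δ N ≤ fourier (llr δ smp) y := by simp
    _ ≤ ∑ y ∈ Finset.univ.erase x, Real.exp (-(N * δ ^ 2 / 8)) :=
        (prob_exists_le _ _).trans <| Finset.sum_le_sum fun y hy =>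
          prob_accept_false_le hε (Finset.ne_of_mem_erase hy) hδ hδ0 N
    _ ≤ ∑ _y : Word s, Real.exp (-(N * δ ^ 2 / 8)) :=
        Finset.sum_le_univ_sum_of_nonneg fun _ => (Real.exp_pos _).le
    _ = 2 ^ s * Real.exp (-(N * δ ^ 2 / 8)) := by simp [ZMod.card]

theorem mul_self_le_mul_sinh (a : ℝ) : a * a ≤ a * Real.sinh a := by
  rcases le_total a 0 with h | h
  · exact mul_le_mul_of_nonpos_left (Real.sinh_le_self_iff.2 h) h
  · exact mul_le_mul_of_nonneg_left (Real.self_le_sinh_iff.2 h) h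

theorem cosh_le_one_add_sq {a : ℝ} (ha : |a| ≤ 1) : Real.cosh a ≤ 1 + a ^ 2 := by
  have ha2 : a ^ 2 ≤ 1 := (sq_le_one_iff_abs_le_one a).2 ha
  have h0 : 0 ≤ a ^ 2 / 2 := by positivity
  have hexp := Real.abs_exp_sub_one_le (x := a ^ 2 / 2) (by rw [abs_of_nonneg h0]; linarith)
  rw [abs_of_nonneg h0] at hexp
  linarith [le_abs_self (Real.exp (a ^ 2 / 2) - 1), Real.cosh_le_exp_half_sq a]

theorem cosh_add_mul_sinh_neg_le (hδ : |δ| < 1) (hδ0 : δ ≠ 0) (hεδ : 3 / 4 * δ ^ 2 ≤ δ * ε) :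
    Real.cosh (-(δ / 8)) + ε * Real.sinh (-(δ / 8)) ≤ Real.exp (-(5 / 64 * δ ^ 2)) := by
  have hδ2 : 0 < δ ^ 2 := by positivity
  have hcosh : Real.cosh (δ / 8) ≤ 1 + (δ / 8) ^ 2 := by
    refine cosh_le_one_add_sq ?_
    rw [abs_div, abs_of_pos (by norm_num : (0 : ℝ) < 8)]
    linarith
  have hsinh : 3 / 32 * δ ^ 2 ≤ ε * Real.sinh (δ / 8) := by
    have hself : δ * (δ / 8) ≤ δ * Real.sinh (δ / 8) := by
      linarith [mul_self_le_mul_sinh (δ / 8)]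
    refine le_of_mul_le_mul_left ?_ hδ2
    nlinarith [mul_le_mul hεδ hself (by nlinarith) (by nlinarith)]
  rw [Real.cosh_neg, Real.sinh_neg]
  linarith [Real.add_one_le_exp (-(5 / 64 * δ ^ 2))]

theorem prob_reject_true_le (hδ : |δ| < 1) (hδ0 : δ ≠ 0) (hεδ : 3 / 4 * δ ^ 2 ≤ δ * ε) (N : ℕ) :
    prob (iid (lpnOracle x ε hε) N) (fun smp => ¬ threshold δ N ≤ fourier (llr δ smp) x) ≤
      Real.exp (-(N * δ ^ 2 / 64)) := by
  have mgf_nonneg : 0 ≤ Real.cosh (-(δ / 8)) + ε * Real.sinh (-(δ / 8)) := by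
    simpa only [expect_exp_agreement, if_true] using expect_nonneg (p := lpnOracle x ε hε)
      fun q => (Real.exp_pos (-(δ / 8) * agreement x q)).le
  calc _ ≤ prob (iid (lpnOracle x ε hε) N)
        fun smp => -(δ ^ 2 * N / 16) ≤ -(δ / 8) * ∑ i, agreement x (smp i) :=
        prob_mono fun smp h => by
          rw [threshold_le_iff hδ hδ0, not_le] at h
          linarith
    _ ≤ Real.exp (δ ^ 2 * N / 16) *
        (Real.cosh (-(δ / 8)) + ε * Real.sinh (-(δ / 8))) ^ N := by
        refine (chernoff_bound (agreement x) N (-(δ ^ 2 * N / 16)) (-(δ / 8))).trans_eq ?_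
        rw [expect_exp_agreement, if_pos rfl, neg_neg]
    _ ≤ Real.exp (δ ^ 2 * N / 16) * Real.exp (-(5 / 64 * δ ^ 2)) ^ N := by
        gcongr
        exact cosh_add_mul_sinh_neg_le hδ hδ0 hεδ
    _ = Real.exp (-(N * δ ^ 2 / 64)) := by
        rw [← Real.exp_nat_mul, ← Real.exp_add]
        congr 1
        ring

end Oracle

/-! ### Random linear codes -/

open PMF (uniformOfFintype)

open Classical in
theorem sum_comp_addMonoidHom {G K : Type*} [AddCommGroup G] [AddCommGroup K] [Fintype G]
    [Fintype K] [DecidableEq K] (φ : G →+ K) (f : K → ℝ) :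
    ∑ g, f (φ g) = (Finset.univ.filter fun g => φ g = 0).card * ∑ k with k ∈ Set.range φ, f k := by
  rw [Finset.sum_comp f φ, Finset.mul_sum]
  refine Finset.sum_congr (by ext k; simp) fun k hk => ?_
  rw [nsmul_eq_mul, AddMonoidHom.card_fiber_eq_of_mem_range φ (Finset.mem_filter.1 hk).2
    ⟨0, map_zero φ⟩]

theorem expect_uniform_comp {G K : Type} [AddCommGroup G] [AddCommGroup K] [Fintype G]
    [Fintype K] {φ : G →+ K} (hφ : Function.Surjective φ) (f : K → ℝ) :
    expect (uniformOfFintype G) (fun g => f (φ g)) = expect (uniformOfFintype K) f := by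
  classical
  have range_eq : (Finset.univ.filter fun k => k ∈ Set.range φ) = Finset.univ := by
    simp [hφ.range_eq]
  have hcard := sum_comp_addMonoidHom φ fun _ => 1
  have hK : (Fintype.card K : ℝ) ≠ 0 := Nat.cast_ne_zero.2 Fintype.card_ne_zero
  have hG : (Fintype.card G : ℝ) ≠ 0 := Nat.cast_ne_zero.2 Fintype.card_ne_zero
  simp only [range_eq, Finset.sum_const, Finset.card_univ, nsmul_eq_mul, mul_one] at hcard
  rw [expect_uniform, expect_uniform, sum_comp_addMonoidHom, range_eq, div_eq_div_iff hG hK, hcard]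
  ring

section RandomCode

variable {m n s : ℕ}

theorem mem_dual_code_iff (H : Matrix (Fin m) (Fin n) (ZMod 2)) (d : Fin n → ZMod 2) :
    d ∈ dual (code H) ↔ ∃ z, Matrix.vecMul z H = d := by
  constructor
  · intro hd
    have annihilates : dotProductEquiv (ZMod 2) (Fin n) d ∈
        (LinearMap.ker H.mulVecLin).dualAnnihilator :=
      (Submodule.mem_dualAnnihilator _).2 fun c hc => (dotProduct_comm d c).trans (hd c hc)
    rw [← LinearMap.range_dualMap_eq_dualAnnihilator_ker] at annihilates
    obtain ⟨φ, hφ⟩ := annihilates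
    obtain ⟨z, rfl⟩ := (dotProductEquiv (ZMod 2) (Fin m)).surjective φ
    refine ⟨z, dotProduct_eq _ _ fun c => ?_⟩
    rw [← Matrix.dotProduct_mulVec]
    exact LinearMap.congr_fun hφ c
  · rintro ⟨z, rfl⟩ c (hc : H.mulVec c = 0)
    rw [dotProduct_comm, ← Matrix.dotProduct_mulVec, hc, dotProduct_zero]

/-- The indicator of the words of weight `w` outside `P`. -/
def hasWeight (w : ℕ) (P : Pos n s) (h : Fin n → ZMod 2) : ℝ :=
  if weightN P h = w then 1 else 0

/-- The sign of `⟨e_𝒩, h_𝒩⟩` if `h` has weight `w` outside `P`, and `0` otherwise. Its sum over the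
parity-checks of a code is the numerator of the bias of the LPN samples. -/
def signedWeight (w : ℕ) (e : Fin n → ZMod 2) (P : Pos n s) (h : Fin n → ZMod 2) : ℝ :=
  hasWeight w P h * sgn (dotN P e h)

theorem bias_eq_sum_sgn {α : Type} (S : Finset α) (g : α → ZMod 2) :
    bias S g = (∑ h ∈ S, sgn (g h)) / S.card := by
  rw [bias, Finset.card_filter, Finset.card_filter]
  push_cast
  rw [← Finset.sum_sub_distrib]
  congr 1
  refine Finset.sum_congr rfl fun h _ => ?_
  rcases zmod_two_eq_zero_or_one (g h) with hg | hg <;> simp [hg]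

open Classical in
theorem sum_hasWeight_mul (H : Matrix (Fin m) (Fin n) (ZMod 2)) (w : ℕ) (P : Pos n s)
    (g : (Fin n → ZMod 2) → ℝ) :
    ∑ z, hasWeight w P (Matrix.vecMul z H) * g (Matrix.vecMul z H) =
      (Finset.univ.filter fun z => Matrix.vecMul z H = 0).card *
        ∑ h ∈ checks (code H) w P, g h := by
  refine (sum_comp_addMonoidHom H.vecMulLinear.toAddMonoidHom
    fun h => hasWeight w P h * g h).trans (congrArg (_ * ·) ?_)
  simp only [hasWeight, ite_mul, one_mul, zero_mul, ← Finset.sum_filter, Finset.filter_filter]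
  refine Finset.sum_congr (Finset.filter_congr fun h _ => ?_) fun _ _ => rfl
  rw [mem_dual_code_iff]
  rfl

theorem lpnBias_code (H : Matrix (Fin m) (Fin n) (ZMod 2)) (w : ℕ) (e : Fin n → ZMod 2)
    (P : Pos n s) :
    lpnBias (code H) w e P = (∑ z, signedWeight w e P (Matrix.vecMul z H)) /
      ∑ z, hasWeight w P (Matrix.vecMul z H) := by
  classical
  have ker_ne_zero : ((Finset.univ.filter fun z => Matrix.vecMul z H = 0).card : ℝ) ≠ 0 :=
    Nat.cast_ne_zero.2 (Finset.card_ne_zero_of_mem (a := 0) (by simp))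
  have numerator := sum_hasWeight_mul H w P fun h => sgn (dotN P e h)
  have denominator := sum_hasWeight_mul H w P fun _ => 1
  simp only [mul_one, Finset.sum_const, nsmul_eq_mul] at denominator
  simp only [signedWeight]
  rw [numerator, denominator, mul_div_mul_left _ _ ker_ne_zero, lpnBias, bias_eq_sum_sgn]

theorem exists_dotProduct_eq {z z' : Fin m → ZMod 2} (hz : z ≠ 0) (hne : z ≠ z') :
    ∃ v, dotProduct z v = 1 ∧ dotProduct z' v = 0 := by
  obtain ⟨i, hi⟩ := Function.ne_iff.1 hz
  obtain ⟨j, hj⟩ := Function.ne_iff.1 hne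
  have hi1 : z i = 1 := (zmod_two_eq_zero_or_one _).resolve_left hi
  rcases zmod_two_eq_zero_or_one (z j) with hj0 | hj1
  · have hj1' : z' j = 1 := (zmod_two_eq_zero_or_one _).resolve_left fun h => hj (hj0.trans h.symm)
    refine ⟨Pi.single i 1 + Pi.single j (z' i), ?_, ?_⟩
    · simp [dotProduct_add, hi1, hj0]
    · simp [dotProduct_add, hj1', CharTwo.add_self_eq_zero]
  · have hj0' : z' j = 0 := (zmod_two_eq_zero_or_one _).resolve_right fun h => hj (hj1.trans h.symm)
    exact ⟨Pi.single j 1, by simp [hj1], by simp [hj0']⟩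

theorem expect_vecMul {z : Fin m → ZMod 2} (hz : z ≠ 0) (f : (Fin n → ZMod 2) → ℝ) :
    expect (uniformOfFintype (Matrix (Fin m) (Fin n) (ZMod 2))) (fun H => f (Matrix.vecMul z H)) =
      expect (uniformOfFintype (Fin n → ZMod 2)) f := by
  obtain ⟨v, hv, -⟩ := exists_dotProduct_eq hz hz
  let φ : Matrix (Fin m) (Fin n) (ZMod 2) →+ (Fin n → ZMod 2) :=
    AddMonoidHom.mk' (fun H => Matrix.vecMul z H) fun A B => Matrix.vecMul_add A B z
  have hφ : Function.Surjective φ := fun a => ⟨Matrix.vecMulVec v a, by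
    simp [φ, Matrix.vecMul_vecMulVec, hv]⟩
  exact expect_uniform_comp hφ f

theorem expect_vecMul_mul {z z' : Fin m → ZMod 2} (hz : z ≠ 0) (hz' : z' ≠ 0) (hne : z ≠ z')
    (f : (Fin n → ZMod 2) → ℝ) :
    expect (uniformOfFintype (Matrix (Fin m) (Fin n) (ZMod 2)))
      (fun H => f (Matrix.vecMul z H) * f (Matrix.vecMul z' H)) =
      expect (uniformOfFintype (Fin n → ZMod 2)) f ^ 2 := by
  obtain ⟨v, hv, hv0⟩ := exists_dotProduct_eq hz hne
  obtain ⟨v', hv', hv0'⟩ := exists_dotProduct_eq hz' hne.symm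
  let φ : Matrix (Fin m) (Fin n) (ZMod 2) →+ (Fin n → ZMod 2) × (Fin n → ZMod 2) :=
    AddMonoidHom.mk' (fun H => (Matrix.vecMul z H, Matrix.vecMul z' H)) fun A B =>
      Prod.ext (Matrix.vecMul_add A B z) (Matrix.vecMul_add A B z')
  have hφ : Function.Surjective φ := fun ⟨a, b⟩ => ⟨Matrix.vecMulVec v a + Matrix.vecMulVec v' b, by
    simp [φ, Matrix.vecMul_add, Matrix.vecMul_vecMulVec, hv, hv', hv0, hv0']⟩
  refine (expect_uniform_comp hφ fun q => f q.1 * f q.2).trans ?_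
  rw [expect_uniform, expect_uniform, Fintype.sum_prod_type, Fintype.card_prod, div_pow, sq,
    Finset.sum_mul_sum, Nat.cast_mul, ← sq]

theorem expect_sum_vecMul_sub_sq_le {f : (Fin n → ZMod 2) → ℝ} (hf : f 0 = 0) :
    expect (uniformOfFintype (Matrix (Fin m) (Fin n) (ZMod 2))) (fun H =>
      (∑ z, f (Matrix.vecMul z H) -
        (2 ^ m - 1) * expect (uniformOfFintype (Fin n → ZMod 2)) f) ^ 2) ≤
      (2 ^ m - 1) * expect (uniformOfFintype (Fin n → ZMod 2)) fun h => f h ^ 2 := by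
  have hcard : ((Finset.univ.erase (0 : Fin m → ZMod 2)).card : ℝ) = 2 ^ m - 1 := by
    rw [Finset.card_erase_of_mem (Finset.mem_univ _), Finset.card_univ,
      Nat.cast_sub Fintype.card_pos]
    simp [ZMod.card]
  have sum_erase (H : Matrix (Fin m) (Fin n) (ZMod 2)) :
      ∑ z, f (Matrix.vecMul z H) = ∑ z ∈ Finset.univ.erase 0, f (Matrix.vecMul z H) :=
    (Finset.sum_erase _ (by rw [Matrix.zero_vecMul, hf])).symm
  simp only [sum_erase, ← hcard]
  exact expect_sum_sub_sq_le _ _ (fun z H => f (Matrix.vecMul z H))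
    (fun z hz => expect_vecMul (Finset.ne_of_mem_erase hz) f)
    (fun z hz => expect_vecMul (Finset.ne_of_mem_erase hz) fun h => f h ^ 2)
    fun z hz z' hz' hne =>
      expect_vecMul_mul (Finset.ne_of_mem_erase hz) (Finset.ne_of_mem_erase hz') hne f

end RandomCode

/-! ### Krawtchouk polynomials as character sums -/

theorem sum_neg_one_pow_card_inter {α : Type*} [DecidableEq α] {E X : Finset α} (hEX : E ⊆ X)
    (w : ℕ) :
    ∑ B ∈ X.powersetCard w, (-1 : ℝ) ^ (B ∩ E).card = krawtchouk X.card w E.card := by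
  have card_inter_mem : ∀ B ∈ X.powersetCard w, (B ∩ E).card ∈ Finset.range (w + 1) :=
    fun B hB => by
      rw [Finset.mem_range, Nat.lt_succ_iff, ← (Finset.mem_powersetCard.1 hB).2]
      exact Finset.card_le_card Finset.inter_subset_left
  rw [← Finset.sum_fiberwise_of_maps_to card_inter_mem, krawtchouk]
  refine Finset.sum_congr rfl fun j hj => ?_
  rw [Finset.sum_congr rfl fun B hB => by rw [(Finset.mem_filter.1 hB).2], Finset.sum_const,
    card_filter_card_inter_eq hEX (Nat.lt_succ_iff.1 (Finset.mem_range.1 hj)),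
    Finset.card_sdiff_of_subset hEX, nsmul_eq_mul]
  push_cast
  ring

theorem krawtchouk_zero (n w : ℕ) : krawtchouk n w 0 = n.choose w := by
  rw [krawtchouk, Finset.sum_eq_single_of_mem 0 (by simp) fun j _ hj => by
    simp [Nat.choose_eq_zero_of_lt (Nat.pos_of_ne_zero hj)]]
  simp

/-- A binary word corresponds to its support. -/
def supportEquiv (n : ℕ) : (Fin n → ZMod 2) ≃ Finset (Fin n) where
  toFun h := Finset.univ.filter fun j => h j ≠ 0
  invFun S := fun j => if j ∈ S then 1 else 0
  left_inv h := by
    funext j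
    rcases zmod_two_eq_zero_or_one (h j) with hj | hj <;> simp [hj]
  right_inv S := by
    ext j
    simp

section CharacterSums

variable {n s : ℕ} (w : ℕ) (e : Fin n → ZMod 2) (P : Pos n s) (h : Fin n → ZMod 2)

theorem supportEquiv_sdiff : supportEquiv n h \ P.1 = P.1ᶜ.filter fun j => h j ≠ 0 := by
  ext j
  simp [supportEquiv, and_comm]

theorem weightN_eq_card : weightN P h = (supportEquiv n h \ P.1).card := by
  rw [supportEquiv_sdiff, weightN]

theorem sgn_dotN :
    sgn (dotN P e h) =
      (-1) ^ ((supportEquiv n h \ P.1) ∩ (supportEquiv n e \ P.1)).card := by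
  have sgn_eq_ite (b : ZMod 2) : sgn b = if b ≠ 0 then -1 else 1 := by
    rcases zmod_two_eq_zero_or_one b with rfl | rfl <;> simp
  rw [dotN, sgn_sum, supportEquiv_sdiff, supportEquiv_sdiff, ← Finset.filter_and,
    ← Finset.prod_const, Finset.prod_filter]
  refine Finset.prod_congr rfl fun j _ => ?_
  rw [sgn_eq_ite]
  exact if_congr (mul_ne_zero_iff.trans and_comm) rfl rfl

theorem sum_supportEquiv_sdiff (F : Finset (Fin n) → ℝ) :
    ∑ h, F (supportEquiv n h \ P.1) = 2 ^ s * ∑ B ∈ P.1ᶜ.powerset, F B :=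
  calc ∑ h, F (supportEquiv n h \ P.1) = ∑ S : Finset (Fin n), F (S \ P.1) :=
        Equiv.sum_comp (supportEquiv n) fun S => F (S \ P.1)
    _ = ∑ _A ∈ P.1.powerset, ∑ B ∈ (Finset.univ \ P.1).powerset, F B := by
        rw [← Finset.powerset_univ]
        exact sum_powerset_inter_sdiff (Finset.subset_univ P.1) fun _ B => F B
    _ = 2 ^ s * ∑ B ∈ P.1ᶜ.powerset, F B := by
        rw [Finset.sum_const, Finset.card_powerset, P.2, nsmul_eq_mul, Nat.cast_pow,
          Nat.cast_ofNat, Finset.compl_eq_univ_sdiff]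

theorem expect_signedWeight :
    expect (uniformOfFintype (Fin n → ZMod 2)) (signedWeight w e P) =
      krawtchouk (n - s) w (weightN P e) * 2 ^ s / 2 ^ n := by
  have sum_signedWeight : ∑ h, signedWeight w e P h = 2 ^ s * ∑ B ∈ P.1ᶜ.powerset,
      if B.card = w then (-1 : ℝ) ^ (B ∩ (supportEquiv n e \ P.1)).card else 0 := by
    rw [← sum_supportEquiv_sdiff P fun B =>
      if B.card = w then (-1 : ℝ) ^ (B ∩ (supportEquiv n e \ P.1)).card else 0]
    simp only [signedWeight, hasWeight, weightN_eq_card, sgn_dotN, ite_mul, one_mul, zero_mul]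
  have support_subset : supportEquiv n e \ P.1 ⊆ P.1ᶜ := by
    rw [Finset.compl_eq_univ_sdiff]
    exact Finset.sdiff_subset_sdiff (Finset.subset_univ _) subset_rfl
  rw [expect_uniform, Fintype.card_fun, ZMod.card, Fintype.card_fin, Nat.cast_pow, Nat.cast_ofNat,
    sum_signedWeight, ← Finset.sum_filter, ← Finset.powersetCard_eq_filter,
    sum_neg_one_pow_card_inter support_subset, Finset.card_compl, P.2, Fintype.card_fin,
    ← weightN_eq_card, mul_comm (2 ^ s)]

theorem expect_hasWeight :
    expect (uniformOfFintype (Fin n → ZMod 2)) (hasWeight w P) =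
      (n - s).choose w * 2 ^ s / 2 ^ n := by
  have weightN_zero : weightN P (0 : Fin n → ZMod 2) = 0 := by simp [weightN]
  have signedWeight_zero : signedWeight w 0 P = hasWeight w P := by
    funext h
    simp [signedWeight, dotN]
  rw [← signedWeight_zero, expect_signedWeight, weightN_zero, krawtchouk_zero]

end CharacterSums

/-! ### The bias of the samples for a random code -/

/-- The bias of the samples has the sign of its estimate `δ`, and at least three quarters of its
absolute value. -/
def HasGoodBias {n s : ℕ} (δ : ℝ) (C : Set (Fin n → ZMod 2)) (w : ℕ) (e : Fin n → ZMod 2)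
    (P : Pos n s) : Prop :=
  3 / 4 * δ ^ 2 ≤ δ * lpnBias C w e P

theorem three_quarters_sq_le_mul_div {δ μ A B : ℝ} (hA : |A - μ| < μ / 10)
    (hB : |B - δ * μ| < |δ| * μ / 10) : 3 / 4 * δ ^ 2 ≤ δ * (B / A) := by
  obtain ⟨hA1, hA2⟩ := abs_lt.1 hA
  have hA0 : 0 < A := by linarith [abs_nonneg (A - μ)]
  have numerator : -(δ ^ 2 * μ / 10) ≤ δ * B - δ ^ 2 * μ := by
    calc -(δ ^ 2 * μ / 10) = -(|δ| * (|δ| * μ / 10)) := by rw [← sq_abs δ]; ring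
      _ ≤ -(|δ| * |B - δ * μ|) := by gcongr
      _ = -|δ * (B - δ * μ)| := by rw [abs_mul]
      _ ≤ δ * (B - δ * μ) := neg_abs_le _
      _ = δ * B - δ ^ 2 * μ := by ring
  rw [mul_div_assoc', le_div_iff₀ hA0]
  nlinarith [sq_nonneg δ]

section BadBias

variable {n s m w : ℕ} {e : Fin n → ZMod 2} {P : Pos n s}

theorem hasWeight_zero (hw : w ≠ 0) : hasWeight w P (0 : Fin n → ZMod 2) = 0 :=
  if_neg (by simpa [weightN] using hw.symm)

theorem hasWeight_sq (h : Fin n → ZMod 2) : hasWeight w P h ^ 2 = hasWeight w P h := by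
  rw [hasWeight, ite_pow, one_pow, zero_pow two_ne_zero]

theorem signedWeight_sq (h : Fin n → ZMod 2) : signedWeight w e P h ^ 2 = hasWeight w P h := by
  rw [signedWeight, mul_pow, hasWeight_sq, sq, ← AddChar.map_add_eq_mul,
    CharTwo.add_self_eq_zero, AddChar.map_zero_eq_one, mul_one]

theorem ne_zero_of_abs_estBias_lt_one {u : ℕ} (h : |estBias n s u w| < 1) : w ≠ 0 := by
  rintro rfl
  simp [estBias, krawtchouk] at h

theorem krawtchouk_eq_estBias_mul {u : ℕ} (h : estBias n s u w ≠ 0) :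
    krawtchouk (n - s) w u = estBias n s u w * (n - s).choose w :=
  (div_mul_cancel₀ _ fun h0 => h (by rw [estBias, h0, div_zero])).symm

theorem prob_not_hasGoodBias_le {δ μ : ℝ} (hδ : estBias n s (weightN P e) w = δ) (hδ0 : δ ≠ 0)
    (hδ1 : |δ| < 1) (hμ0 : 0 < μ)
    (hμ : (2 ^ m - 1) * ((n - s).choose w * 2 ^ s / 2 ^ n) = μ) :
    prob (uniformOfFintype (Matrix (Fin m) (Fin n) (ZMod 2)))
      (fun H => ¬ HasGoodBias δ (code H) w e P) ≤ 200 / (δ ^ 2 * μ) := by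
  set p := uniformOfFintype (Matrix (Fin m) (Fin n) (ZMod 2))
  have hw : w ≠ 0 := ne_zero_of_abs_estBias_lt_one (hδ ▸ hδ1)
  have mean_signed : (2 ^ m - 1) * expect (uniformOfFintype _) (signedWeight w e P) = δ * μ := by
    rw [expect_signedWeight, krawtchouk_eq_estBias_mul (hδ.trans_ne hδ0), hδ, ← hμ]
    ring
  have mean_has : (2 ^ m - 1) * expect (uniformOfFintype _) (hasWeight w P) = μ := by
    rw [expect_hasWeight, hμ]
  have variance_has := expect_sum_vecMul_sub_sq_le (m := m) (hasWeight_zero (P := P) hw)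
  have variance_signed := expect_sum_vecMul_sub_sq_le (m := m) (f := signedWeight w e P)
    (by rw [signedWeight, hasWeight_zero hw, zero_mul])
  simp only [hasWeight_sq, signedWeight_sq, mean_signed, mean_has] at variance_has variance_signed
  calc _ ≤ prob p fun H => μ / 10 ≤ |∑ z, hasWeight w P (Matrix.vecMul z H) - μ| ∨
        |δ| * μ / 10 ≤ |∑ z, signedWeight w e P (Matrix.vecMul z H) - δ * μ| :=
        prob_mono fun H hH => by
          contrapose! hH
          rw [HasGoodBias, lpnBias_code]
          exact three_quarters_sq_le_mul_div hH.1 hH.2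
    _ ≤ μ / (μ / 10) ^ 2 + μ / (|δ| * μ / 10) ^ 2 := by
        refine (prob_or_le _ _).trans (add_le_add ?_ ?_)
        · exact (chebyshev_inequality _ (by positivity)).trans (by gcongr)
        · exact (chebyshev_inequality _ (by positivity)).trans (by gcongr)
    _ = 100 * (δ ^ 2 + 1) / (δ ^ 2 * μ) := by
        rw [div_pow (|δ| * μ), mul_pow, sq_abs]
        field_simp
        norm_num
    _ ≤ 200 / (δ ^ 2 * μ) := by
        have : δ ^ 2 ≤ 1 := (sq_le_one_iff_abs_le_one δ).2 hδ1.le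
        gcongr
        linarith

end BadBias

/-! ### Success probability of the decoder -/

theorem two_pow_le_exp (n : ℕ) : (2 : ℝ) ^ n ≤ Real.exp n := by
  rw [← Real.exp_one_pow]
  gcongr
  linarith [Real.exp_one_gt_d9]

theorem exp_neg_le_quarter {x : ℝ} (hx : 2 ≤ x) : Real.exp (-x) ≤ 1 / 4 := by
  have four_le : (4 : ℝ) ≤ Real.exp x := by
    linarith [two_pow_le_exp 2, Real.exp_le_exp.2 ((Nat.cast_two (R := ℝ)).trans_le hx)]
  rw [Real.exp_neg, one_div]
  exact inv_anti₀ (by norm_num) four_le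

section Iteration

variable {n s N w u t : ℕ} {e : Fin n → ZMod 2} {C : Set (Fin n → ZMod 2)} {δ ε : ℝ}

theorem two_pow_mul_exp_le (hs : s ≤ n) (hX : 128 * (n : ℝ) ≤ N * δ ^ 2) :
    (2 : ℝ) ^ s * Real.exp (-(N * δ ^ 2 / 8)) ≤ Real.exp (-(15 * n)) := by
  calc (2 : ℝ) ^ s * Real.exp (-(N * δ ^ 2 / 8)) ≤ Real.exp n * Real.exp (-(16 * n)) := by
        gcongr
        · exact (pow_le_pow_right₀ one_le_two hs).trans (two_pow_le_exp n)
        · linarith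
    _ = Real.exp (-(15 * n)) := by
        rw [← Real.exp_add]
        ring_nf

theorem half_le_prob_mem_solveVal (hs : s ≤ n) (hn : 1 ≤ n) (x : Word s) (hδ : |δ| < 1)
    (hδ0 : δ ≠ 0) (hX : 128 * (n : ℝ) ≤ N * δ ^ 2) (hε : |ε| ≤ 1) (hεδ : 3 / 4 * δ ^ 2 ≤ δ * ε) :
    1 / 2 ≤ prob (iid (lpnOracle x ε hε) N) fun smp => x ∈ solveVal δ smp := by
  have one_le_n : (1 : ℝ) ≤ n := Nat.one_le_cast.2 hn
  have reject_true : prob (iid (lpnOracle x ε hε) N)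
      (fun smp => ¬ threshold δ N ≤ fourier (llr δ smp) x) ≤ 1 / 4 :=
    (prob_reject_true_le x hε hδ hδ0 hεδ N).trans (exp_neg_le_quarter (by linarith))
  have accept_wrong : prob (iid (lpnOracle x ε hε) N)
      (fun smp => ∃ y ≠ x, threshold δ N ≤ fourier (llr δ smp) y) ≤ 1 / 4 :=
    ((prob_accept_wrong_le x hε hδ hδ0 N).trans (two_pow_mul_exp_le hs hX)).trans
      (exp_neg_le_quarter (by linarith))
  have miss : prob (iid (lpnOracle x ε hε) N) (fun smp => ¬ x ∈ solveVal δ smp) ≤ 1 / 4 + 1 / 4 :=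
    calc _ ≤ prob (iid (lpnOracle x ε hε) N) fun smp => ¬ threshold δ N ≤ fourier (llr δ smp) x ∨
          ∃ y ≠ x, threshold δ N ≤ fourier (llr δ smp) y :=
          prob_mono fun smp h => by
            contrapose! h
            exact mem_solveVal h.1 (by simpa using h.2)
      _ ≤ 1 / 4 + 1 / 4 := (prob_or_le _ _).trans (add_le_add reject_true accept_wrong)
  rw [prob_not] at miss
  linarith

theorem prob_iteration (hs : s ≤ n) (A : Pos n s × (Fin N → Sample s) → Prop) :
    prob (iteration hs N w e C) A = expect (uniformPos hs) fun P =>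
      prob (iid (lpnOracle (onP P e) (lpnBias C w e P) (abs_bias_le_one _ _)) N)
        fun smp => A (P, smp) := by
  simp only [iteration, prob_bind, prob_map]

theorem prob_wrong_iteration_le (hs : s ≤ n) (hδ : |δ| < 1) (hδ0 : δ ≠ 0)
    (hX : 128 * (n : ℝ) ≤ N * δ ^ 2) :
    prob (iteration hs N w e C) (fun q => ∃ x ∈ solveVal δ q.2, x ≠ onP q.1 e) ≤
      Real.exp (-(15 * n)) := by
  rw [prob_iteration, ← expect_const (uniformPos hs) (Real.exp _)]
  refine expect_mono fun P => ?_
  calc _ ≤ prob _ fun smp => ∃ y ≠ onP P e, threshold δ N ≤ fourier (llr δ smp) y :=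
        prob_mono fun smp ⟨x, hx, hne⟩ => ⟨x, hne, threshold_le_of_mem_solveVal hx⟩
    _ ≤ 2 ^ s * Real.exp (-(N * δ ^ 2 / 8)) := prob_accept_wrong_le _ _ hδ hδ0 N
    _ ≤ Real.exp (-(15 * n)) := two_pow_mul_exp_le hs hX

theorem prob_weightN_eq (hs : s ≤ n) (hut : u ≤ t) (hun : u ≤ n - s) (he : hammingNorm e = t) :
    prob (uniformPos hs) (fun P => weightN P e = u) = pSucc n s t u := by
  have pSucc_nonneg : 0 ≤ pSucc n s t u := by
    rw [pSucc]
    positivity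
  refine (ENNReal.ofReal_eq_ofReal_iff (prob_nonneg _) pSucc_nonneg).1 ?_
  rw [← uniformPos_weightN_eq hs hut hun he, toOuterMeasure_eq_ofReal_prob]
  rfl

/-- The probability that a random set of positions leaves `u` errors outside and that the samples
for it have a bad bias. -/
def badBiasProb (hs : s ≤ n) (δ : ℝ) (C : Set (Fin n → ZMod 2)) (w u : ℕ) (e : Fin n → ZMod 2) :
    ℝ :=
  prob (uniformPos hs) fun P => weightN P e = u ∧ ¬ HasGoodBias δ C w e P

theorem le_prob_right_iteration (hs : s ≤ n) (hn : 1 ≤ n) (hut : u ≤ t) (hun : u ≤ n - s)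
    (he : hammingNorm e = t) (hδ : |δ| < 1) (hδ0 : δ ≠ 0) (hX : 128 * (n : ℝ) ≤ N * δ ^ 2)
    (hgood : 2 * badBiasProb hs δ C w u e ≤ pSucc n s t u) :
    pSucc n s t u / 4 ≤ prob (iteration hs N w e C) fun q => onP q.1 e ∈ solveVal δ q.2 := by
  classical
  calc pSucc n s t u / 4
      ≤ 1 / 2 * (prob (uniformPos hs) (fun P => weightN P e = u) - badBiasProb hs δ C w u e) := by
        rw [prob_weightN_eq hs hut hun he]
        linarith
    _ ≤ _ := by
        rw [prob_iteration, badBiasProb, prob, prob, ← expect_sub, ← expect_const_mul]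
        refine expect_mono fun P => ?_
        by_cases hu : weightN P e = u
        · by_cases hP : HasGoodBias δ C w e P
          · rw [if_pos hu, if_neg fun h => h.2 hP, sub_zero, mul_one]
            exact half_le_prob_mem_solveVal hs hn (onP P e) hδ hδ0 hX (abs_bias_le_one _ _) hP
          · rw [if_pos hu, if_pos ⟨hu, hP⟩, sub_self, mul_zero]
            exact prob_nonneg _
        · rw [if_neg hu, if_neg fun h => hu h.1, sub_self, mul_zero]
          exact prob_nonneg _

theorem one_div_pSucc_le (hp : 0 < pSucc n s t u) : 1 / pSucc n s t u ≤ Real.exp n := by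
  have numerator_pos : 0 < s.choose (t - u) * (n - s).choose u := by
    refine Nat.pos_of_ne_zero fun h => hp.ne' ?_
    rw [pSucc, ← Nat.cast_mul, h, Nat.cast_zero, zero_div]
  rw [pSucc, one_div_div]
  calc (n.choose t : ℝ) / (s.choose (t - u) * (n - s).choose u) ≤ n.choose t :=
        div_le_self (Nat.cast_nonneg _) (by exact_mod_cast numerator_pos)
    _ ≤ 2 ^ n := by exact_mod_cast Nat.choose_le_two_pow n t
    _ ≤ Real.exp n := two_pow_le_exp n

theorem isCorrect_iff_exists_mem (r : Option (Pos n s × Word s)) :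
    IsCorrect e r ↔ ∃ y ∈ r, y.2 = onP y.1 e := by
  constructor
  · rintro ⟨P, rfl⟩
    exact ⟨_, rfl, rfl⟩
  · rintro ⟨⟨P, x⟩, hr, hx⟩
    obtain rfl : x = onP P e := hx
    exact ⟨P, hr⟩

theorem prob_decoderVal_fail_le (hs : s ≤ n) (hn : 1 ≤ n) (hut : u ≤ t) (hun : u ≤ n - s)
    (he : hammingNorm e = t) (hδ : |δ| < 1) (hδ0 : δ ≠ 0) (hX : 128 * (n : ℝ) ≤ N * δ ^ 2)
    (hp : 0 < pSucc n s t u) (hgood : 2 * badBiasProb hs δ C w u e ≤ pSucc n s t u) (Niter : ℕ) :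
    prob (iid (iteration hs N w e C) Niter)
      (fun it => ¬ IsCorrect e (decoderVal δ (List.ofFn it))) ≤
      Real.exp (-(Niter * pSucc n s t u / 4)) + 4 * Real.exp (-n) := by
  set p := pSucc n s t u
  have hp1 : p ≤ 1 := pSucc_le_one hs hut hun he
  simp only [isCorrect_iff_exists_mem, decoderVal]
  refine (prob_not_good_findSome_le _ _ (g := p / 4) (b := Real.exp (-(15 * n))) (by linarith)
    ?_ ?_ Niter).trans (add_le_add ?_ ?_)
  · refine (le_prob_right_iteration hs hn hut hun he hδ hδ0 hX hgood).trans (prob_mono ?_)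
    exact fun q hq => ⟨_, Option.mem_map_of_mem _ hq, rfl⟩
  · refine (prob_mono ?_).trans (prob_wrong_iteration_le hs hδ hδ0 hX)
    rintro q ⟨y, hy, hne⟩
    obtain ⟨x, hx, rfl⟩ := Option.mem_map.1 hy
    exact ⟨x, hx, hne⟩
  · calc (1 - p / 4) ^ Niter ≤ Real.exp (-(p / 4)) ^ Niter :=
          pow_le_pow_left₀ (by linarith) (Real.one_sub_le_exp_neg _) _
      _ = Real.exp (-(Niter * p / 4)) := by
          rw [← Real.exp_nat_mul]
          ring_nf
  · calc Real.exp (-(15 * n)) / (p / 4) = 4 * (Real.exp (-(15 * n)) * (1 / p)) := by field_simp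
      _ ≤ 4 * (Real.exp (-(15 * n)) * Real.exp n) := by
          gcongr
          exact one_div_pSucc_le hp
      _ ≤ 4 * Real.exp (-n) := by
          rw [← Real.exp_add]
          gcongr
          linarith [Nat.cast_nonneg (α := ℝ) n]

end Iteration

section Experiment

variable {n k s N w t u : ℕ} {e : Fin n → ZMod 2} {δ : ℝ}

theorem choose_mul_two_pow_le (hs : s ≤ n) : ((n - s).choose w : ℝ) * 2 ^ s ≤ 2 ^ n := by
  rw [← Nat.sub_add_cancel hs, pow_add, Nat.add_sub_cancel]
  gcongr
  exact_mod_cast Nat.choose_le_two_pow _ _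

theorem half_le_mean_checks (hk : k ≤ n) (hs : s ≤ n) (hN1 : 1 < N)
    (hN : (N : ℝ) ≤ ((n - s).choose w : ℝ) / (2 : ℝ) ^ ((k : ℤ) - (s : ℤ))) :
    (N : ℝ) / 2 ≤ (2 ^ (n - k) - 1) * ((n - s).choose w * 2 ^ s / 2 ^ n) := by
  have hN1' : (1 : ℝ) < N := Nat.one_lt_cast.2 hN1
  rw [zpow_sub₀ two_ne_zero, zpow_natCast, zpow_natCast, div_div_eq_mul_div] at hN
  have k_ne_n : k ≠ n := by
    rintro rfl
    linarith [div_le_one_of_le₀ (choose_mul_two_pow_le (w := w) hs) (by positivity)]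
  have two_pow_n : (2 : ℝ) ^ n = 2 ^ (n - k) * 2 ^ k := by
    rw [← pow_add, Nat.sub_add_cancel hk]
  have two_le : (2 : ℝ) ≤ 2 ^ (n - k) := le_self_pow₀ one_le_two (by omega)
  calc (N : ℝ) / 2 ≤ ((n - s).choose w * 2 ^ s / 2 ^ k) / 2 := by linarith
    _ = 2 ^ (n - k) / 2 * ((n - s).choose w * 2 ^ s / 2 ^ n) := by
        rw [two_pow_n]
        field_simp
    _ ≤ _ := by
        gcongr
        linarith

theorem expect_badBiasProb_le {m : ℕ} (hs : s ≤ n) (hut : u ≤ t) (hun : u ≤ n - s)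
    (he : hammingNorm e = t) {c : ℝ}
    (hc : ∀ P : Pos n s, weightN P e = u →
      prob (uniformOfFintype (Matrix (Fin m) (Fin n) (ZMod 2)))
        (fun H => ¬ HasGoodBias δ (code H) w e P) ≤ c) :
    expect (uniformOfFintype (Matrix (Fin m) (Fin n) (ZMod 2)))
      (fun H => badBiasProb hs δ (code H) w u e) ≤ pSucc n s t u * c := by
  simp only [badBiasProb, prob]
  rw [expect_comm, ← prob_weightN_eq hs hut hun he, prob, ← expect_mul_const]
  refine expect_mono fun P => ?_
  by_cases hP : weightN P e = u
  · rw [if_pos hP, one_mul]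
    exact (prob_mono fun H hH => hH.2).trans (hc P hP)
  · simp [hP, expect_const]

theorem prob_experiment_fail_le (hk : k ≤ n) (hs : s ≤ n) (hn : 1 ≤ n) (hut : u ≤ t)
    (hun : u ≤ n - s) (he : hammingNorm e = t) (hδe : estBias n s u w = δ) (hδ : |δ| < 1)
    (hδ0 : δ ≠ 0) (hN : (N : ℝ) ≤ ((n - s).choose w : ℝ) / (2 : ℝ) ^ ((k : ℤ) - (s : ℤ)))
    (hX : 128 * (n : ℝ) ≤ N * δ ^ 2) (hp : 0 < pSucc n s t u) (Niter : ℕ) :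
    prob (experiment hs k N w Niter e)
      (fun it => ¬ IsCorrect e (decoderVal δ (List.ofFn it))) ≤
      800 / (N * δ ^ 2) + (Real.exp (-(Niter * pSucc n s t u / 4)) + 4 * Real.exp (-n)) := by
  have hN1 : 1 < N := by
    have hδ2 : δ ^ 2 ≤ 1 := (sq_le_one_iff_abs_le_one δ).2 hδ.le
    have : (1 : ℝ) ≤ n := Nat.one_le_cast.2 hn
    exact_mod_cast (show (1 : ℝ) < N by
      linarith [mul_le_of_le_one_right (Nat.cast_nonneg (α := ℝ) N) hδ2])
  have hN0 : (0 : ℝ) < N := Nat.cast_pos.2 (by omega)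
  have hμN := half_le_mean_checks hk hs hN1 hN
  set μ : ℝ := (2 ^ (n - k) - 1) * ((n - s).choose w * 2 ^ s / 2 ^ n) with hμ
  have hμ0 : 0 < μ := by linarith
  have bad_bias : ∀ P : Pos n s, weightN P e = u →
      prob (uniformOfFintype (Matrix (Fin (n - k)) (Fin n) (ZMod 2)))
        (fun H => ¬ HasGoodBias δ (code H) w e P) ≤ 400 / (N * δ ^ 2) := fun P hP =>
    calc _ ≤ 200 / (δ ^ 2 * μ) := prob_not_hasGoodBias_le (by rwa [hP]) hδ0 hδ hμ0 hμ.symm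
      _ ≤ 200 / (δ ^ 2 * (N / 2)) := by gcongr
      _ = 400 / (N * δ ^ 2) := by
        field_simp
        norm_num
  have bad_code : prob (uniformOfFintype (Matrix (Fin (n - k)) (Fin n) (ZMod 2)))
      (fun H => pSucc n s t u / 2 ≤ badBiasProb hs δ (code H) w u e) ≤ 800 / (N * δ ^ 2) :=
    calc _ ≤ _ / (pSucc n s t u / 2) := markov_inequality (fun H => prob_nonneg _) (half_pos hp)
      _ ≤ pSucc n s t u * (400 / (N * δ ^ 2)) / (pSucc n s t u / 2) := by
        gcongr
        exact expect_badBiasProb_le hs hut hun he bad_bias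
      _ = 800 / (N * δ ^ 2) := by
        field_simp
        norm_num
  refine (prob_bind_le_add (by positivity) fun H hH => ?_).trans (add_le_add_left bad_code _)
  exact prob_decoderVal_fail_le hs hn hut hun he hδ hδ0 hX hp (by linarith) Niter

end Experiment

section Asymptotics

open Filter Topology

theorem tendsto_fail_bound {X Y : ℕ → ℝ} (hX : Tendsto X atTop atTop) (hY : Tendsto Y atTop atTop) :
    Tendsto (fun n : ℕ => 800 / X n + (Real.exp (-(Y n / 4)) + 4 * Real.exp (-n))) atTop (𝓝 0) := by
  have exp_n := (Real.tendsto_exp_neg_atTop_nhds_zero.comp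
    (tendsto_natCast_atTop_atTop (R := ℝ))).const_mul 4
  have exp_Y := Real.tendsto_exp_neg_atTop_nhds_zero.comp
    (hY.atTop_div_const (show (0 : ℝ) < 4 by norm_num))
  simpa using (hX.const_div_atTop 800).add (exp_Y.add exp_n)

theorem tendsto_toOuterMeasure_one {α : ℕ → Type} [∀ n, Fintype (α n)] (p : ∀ n, PMF (α n))
    {A : ∀ n, α n → Prop} {r : ℕ → ℝ} (hr : Tendsto r atTop (𝓝 0))
    (h : ∀ᶠ n in atTop, prob (p n) (fun x => ¬ A n x) ≤ r n) :
    Tendsto (fun n => (p n).toOuterMeasure {x | A n x}) atTop (𝓝 1) := by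
  have lower : Tendsto (fun n => 1 - r n) atTop (𝓝 1) := by simpa using hr.const_sub 1
  have prob_tendsto : Tendsto (fun n => prob (p n) (A n)) atTop (𝓝 1) := by
    refine tendsto_of_tendsto_of_tendsto_of_le_of_le' lower tendsto_const_nhds ?_
      (Eventually.of_forall fun n => prob_le_one _)
    filter_upwards [h] with n hn
    rw [prob_not] at hn
    linarith
  simpa only [toOuterMeasure_eq_ofReal_prob, Set.mem_ofPred_eq, ENNReal.ofReal_one] using
    ENNReal.tendsto_ofReal prob_tendsto

theorem tendsto_success {k s t u w N Niter : ℕ → ℕ} (hk : ∀ n, k n ≤ n) (hs : ∀ n, s n ≤ n)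
    (hut : ∀ n, u n ≤ t n) (hun : ∀ n, u n ≤ n - s n)
    (e : ∀ n, Fin n → ZMod 2) (he : ∀ n, hammingNorm (e n) = t n)
    (hδ : ∀ᶠ n in atTop, |estBias n (s n) (u n) (w n)| < 1)
    (hN : ∀ᶠ n in atTop,
      (N n : ℝ) ≤ ((n - s n).choose (w n) : ℝ) / (2 : ℝ) ^ ((k n : ℤ) - (s n : ℤ)))
    (hX : IsOmega (fun n => (N n : ℝ)) (fun n => (n : ℝ) *
      (((n - s n).choose (w n) : ℝ) / krawtchouk (n - s n) (w n) (u n)) ^ 2))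
    (hY : IsOmega (fun n => (Niter n : ℝ)) (fun n => 1 / pSucc n (s n) (t n) (u n)))
    (M : ∀ n, Mem (s n)) :
    Tendsto (fun n => (experiment (hs n) (k n) (N n) (w n) (Niter n) (e n)).toOuterMeasure
      {it | IsCorrect (e n) ((rlpnOn (estBias n (s n) (u n) (w n)) it).run (M n)).1})
      atTop (𝓝 1) := by
  have ratio_tendsto : Tendsto (fun n => (N n : ℝ) * estBias n (s n) (u n) (w n) ^ 2 / n)
      atTop atTop := hX.congr fun n => by
    dsimp only
    rw [Nat.abs_cast, estBias, ← inv_div (krawtchouk (n - s n) (w n) (u n)), inv_pow,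
      ← div_eq_mul_inv, div_div_eq_mul_div]
  have expected_hits_tendsto : Tendsto (fun n => (Niter n : ℝ) * pSucc n (s n) (t n) (u n))
      atTop atTop := hY.congr fun n => by
    simp only [Nat.abs_cast, one_div, div_inv_eq_mul]
  refine tendsto_toOuterMeasure_one _ (tendsto_fail_bound ratio_tendsto expected_hits_tendsto) ?_
  filter_upwards [hδ, hN, ratio_tendsto.eventually_ge_atTop 128,
    expected_hits_tendsto.eventually_gt_atTop 0, eventually_ge_atTop 1] with n hδ hN hX hY hn
  have one_le_n : (1 : ℝ) ≤ n := Nat.one_le_cast.2 hn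
  have samples : 128 * (n : ℝ) ≤ N n * estBias n (s n) (u n) (w n) ^ 2 :=
    (le_div_iff₀ (by linarith)).1 hX
  have hδ0 : estBias n (s n) (u n) (w n) ≠ 0 := fun h => by
    rw [h, zero_pow two_ne_zero, mul_zero] at samples
    linarith
  simp only [run_rlpnOn]
  refine (prob_experiment_fail_le (hk n) (hs n) hn (hut n) (hun n) (he n) rfl hδ hδ0 hN samples
    (pos_of_mul_pos_right hY (Nat.cast_nonneg _)) (Niter n)).trans ?_
  gcongr
  exact div_le_self (by positivity) one_le_n

end Asymptotics

end

end RLPN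

open RLPN in
theorem mainTheorem3
    (k s t u w N Niter : ℕ → ℕ)
    (hk : ∀ n, k n ≤ n) (hs : ∀ n, s n ≤ n) (hut : ∀ n, u n ≤ t n) (hun : ∀ n, u n ≤ n - s n)
    (e : ∀ n, Fin n → ZMod 2) (he : ∀ n, hammingNorm (e n) = t n) :
    -- the probability that there are exactly `u` errors outside a random set of `s` positions
    (∀ n, (uniformPos (hs n)).toOuterMeasure {P | weightN P (e n) = u n} =
      ENNReal.ofReal (pSucc n (s n) (t n) (u n))) ∧
    -- on any samples, an iteration maximizes the Fourier transform of the log-likelihood function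
    (∀ (n : ℕ) (δ : ℝ) (smp : Fin (N n) → Sample (s n)) (M : Mem (s n)),
      IterSpec δ smp ((load smp >>= fun _ => solve (s n) (N n) δ).run M).1) ∧
    -- the samples which the decoder works on are LPN samples with secret `e_𝒫`
    (∀ (n Seq Teq : ℕ) (δ : ℝ) (H : Matrix (Fin (n - k n)) (Fin n) (ZMod 2)) (c : Fin n → ZMod 2)
      (P : Fin (Niter n) → Pos n (s n)) (create : Fin (Niter n) → Prog (s n) Unit)
      (W : Finset (Cell (s n))) (M : Mem (s n)),
      IsExecution (k n) (N n) (w n) Seq Teq (e n) H c P create W M →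
      ∃ h : Fin (Niter n) → Fin (N n) → Fin n → ZMod 2,
        (∀ j, AreChecks (code H) (w n) (P j) (h j)) ∧
        ((rlpn (N n) δ P create).run M).1 =
          ((rlpnOn δ fun j => (P j, lpnSamples (onP (P j) (e n)) (fun i => onP (P j) (h j i))
            fun i => dotN (P j) (e n) (h j i))).run M).1) ∧
    -- space and time
    (∀ Seq Teq : ℕ → ℕ,
      (∃ K : ℝ, ∀ (n : ℕ) (δ : ℝ) (H : Matrix (Fin (n - k n)) (Fin n) (ZMod 2))
        (c : Fin n → ZMod 2) (P : Fin (Niter n) → Pos n (s n))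
        (create : Fin (Niter n) → Prog (s n) Unit) (W : Finset (Cell (s n))) (M : Mem (s n)),
        1 ≤ n → 1 ≤ N n →
        IsExecution (k n) (N n) (w n) (Seq n) (Teq n) (e n) H c P create W M →
        ((((rlpn (N n) δ P create).cells M).card : ℝ) ≤ K * (Seq n + 2 ^ s n)) ∧
        (((rlpn (N n) δ P create).time M : ℝ) ≤
          K * (Niter n * (Teq n + (s n + 1) * 2 ^ s n)))) ∧
      ((∀ᶠ n in Filter.atTop, 1 ≤ N n) →
        (∀ᶠ n in Filter.atTop, 0 < pSucc n (s n) (t n) (u n)) →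
        (∃ a : ℕ, (fun n => (Niter n : ℝ)) =O[Filter.atTop] fun n =>
          1 / pSucc n (s n) (t n) (u n) *
            Real.log ((Teq n + 2 ^ s n) / pSucc n (s n) (t n) (u n)) ^ a) →
        ∃ (K : ℝ) (a : ℕ), ∀ᶠ n in Filter.atTop,
          ∀ (δ : ℝ) (H : Matrix (Fin (n - k n)) (Fin n) (ZMod 2))
          (c : Fin n → ZMod 2) (P : Fin (Niter n) → Pos n (s n))
          (create : Fin (Niter n) → Prog (s n) Unit) (W : Finset (Cell (s n))) (M : Mem (s n)),
          IsExecution (k n) (N n) (w n) (Seq n) (Teq n) (e n) H c P create W M →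
          ((rlpn (N n) δ P create).time M : ℝ) ≤
            K * ((Teq n + 2 ^ s n) / pSucc n (s n) (t n) (u n) *
              Real.log ((Teq n + 2 ^ s n) / pSucc n (s n) (t n) (u n)) ^ a))) ∧
    -- correctness
    ((∀ᶠ n in Filter.atTop, |estBias n (s n) (u n) (w n)| < 1) →
      (∀ᶠ n in Filter.atTop,
        (N n : ℝ) ≤ ((n - s n).choose (w n) : ℝ) / (2 : ℝ) ^ ((k n : ℤ) - (s n : ℤ))) →
      IsOmega (fun n => (N n : ℝ))
        (fun n => (n : ℝ) *
          (((n - s n).choose (w n) : ℝ) / krawtchouk (n - s n) (w n) (u n)) ^ 2) →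
      IsOmega (fun n => (Niter n : ℝ)) (fun n => 1 / pSucc n (s n) (t n) (u n)) →
      ∀ M : ∀ n, Mem (s n),
        Filter.Tendsto (fun n =>
          (experiment (hs n) (k n) (N n) (w n) (Niter n) (e n)).toOuterMeasure
            {it | IsCorrect (e n)
              ((rlpnOn (estBias n (s n) (u n) (w n)) it).run (M n)).1})
          Filter.atTop (nhds 1)) := by
  refine ⟨fun n => uniformPos_weightN_eq (hs n) (hut n) (hun n) (he n),
    fun n δ smp M => iterSpec_load_solve δ smp M, ?_, fun Seq Teq => ⟨⟨40, ?_⟩, ?_⟩,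
    tendsto_success hk hs hut hun e he⟩
  · rintro n Seq Teq δ H c P create W M ⟨hc, -, hcreate, hinput⟩
    obtain ⟨h, hchecks, hdoes⟩ := rlpn_does δ (e n) hc hcreate hinput
    exact ⟨h, hchecks, by rw [hdoes.post, run_rlpnOn]⟩
  · intro n δ H c P create W M hn hN hex
    have space : ((rlpn (N n) δ P create).cells M).card ≤ 40 * (Seq n + 2 ^ s n) :=
      (card_cells_le (hs n) hn hN hex).trans (Nat.mul_le_mul_right _ (by norm_num))
    exact ⟨by exact_mod_cast space, by exact_mod_cast time_le (hs n) hn hN hex⟩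
  · exact fun hN hp ⟨a, hO⟩ =>
      time_isSoftO hs e (fun n => pSucc_le_one (hs n) (hut n) (hun n) (he n)) hN hp hO
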